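/- Let $k\ge 2$ be an integer, $q$ a prime power and $n>1$ an integer. For $m\ge 1$ let $\mu_{q,k}(m)$ be the least $s$ such that there are $\mathbb F_q$-linear forms $a_{i,j}:\mathbb F_{q^m}\to\mathbb F_q$ and elements $c_i\in\mathbb F_{q^m}$ ($1\le i\le s$, $1\le j\le k$) with $\prod_{j=1}^k x_j=\sum_{i=1}^s\bigl(\prod_{j=1}^k a_{i,j}(x_j)\bigr)c_i$ for all $x_1,\dots,x_k\in\mathbb F_{q^m}$, and put $\mu_q(m)=\mu_{q,2}(m)$. Let $\nu_{q,k}(m)$ be the least number of multiplications of two quantities in $\mathbb F_q$ in a straight-line computation of the product $x_1\cdots x_k$ of $k$ elements of $\mathbb F_{q^m}$ over $\mathbb F_q$ whose inputs are the coordinates of the $x_j$, and in which additions and multiplications by constants of $\mathbb F_q$ are free. Let $F/\mathbb F_q$ be an algebraic function field of one variable, of genus $g=\max_A(\deg A-\ell(A)+1)$, where $A$ runs over the divisors of $F/\mathbb F_q$ and $\ell(A)=\dim_{\mathbb F_q}\mathcal L(A)$. Suppose that $F/\mathbb F_q$ has a place of degree $n$ and a divisor $R$ of degree $g-1$ that is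 non-special, i.e. $\ell(R)=\deg R+1-g$. Let $r\ge 1$ be an integer, and for $1\le i\le r$ let $\mathcal P_i$ be a finite set of places of degree $i$ of $F/\mathbb F_q$, with $N_i$ elements, such that $$\sum_{i=1}^r iN_i>kn+kg-k .$$ Then $$\mu_{q,k}(n)\le\sum_{i=1}^r N_i\,\mu_{q,k}(i).$$ Moreover, if $r_0,r_0'\ge 1$ are integers such that $$\frac{\mu_{q,k}(r_0)}{r_0}=\sup_{1\le i\le r}\frac{\mu_{q,k}(i)}{i}\quad\text{and}\quad\frac{\mu_q(r_0')}{r_0'}=\sup_{1\le i\le r}\frac{\mu_q(i)}{i},$$ then $$\mu_{q,k}(n)\le(kn+kg-k+r)\,\frac{\mu_{q,k}(r_0)}{r_0},\qquad \nu_{q,k}(n)\le(k-1)(kn+kg-k+r)\,\frac{\mu_q(r_0')}{r_0'} .$$ -/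

import Mathlib

open scoped Polynomial WithZero

noncomputable section

/-! ### The extension `𝔽_{q^n}` of a finite field -/

/-- The extension of degree `n ≥ 1` of a finite field `K` with `q` elements, as the splitting field
of `X ^ (q ^ n) - X` over `K`. -/
abbrev FiniteExt (K : Type*) [Field K] (n : ℕ) : Type _ :=
  (Polynomial.X ^ (Nat.card K ^ n) - Polynomial.X : K[X]).SplittingField

/-- The extension `FiniteExt K n` has degree `n` over `K`. -/
theorem finrank_finiteExt (K : Type*) [Field K] [Finite K] (n : ℕ) (hn : 1 ≤ n) :
    Module.finrank K (FiniteExt K n) = n := by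
  have : NeZero n := ⟨by omega⟩
  obtain ⟨p, hp⟩ := CharP.exists K
  have : Fact p.Prime := ⟨CharP.char_is_prime K p⟩
  have e := Polynomial.IsSplittingField.algEquiv (FiniteField.Extension K p n)
    (Polynomial.X ^ (Nat.card K ^ n) - Polynomial.X : K[X])
  rw [← e.toLinearEquiv.finrank_eq, FiniteField.finrank_extension]

/-! ### Complexities of the multiplication of `k` elements -/

/-- There is a `k`-multilinear multiplication algorithm with `s` summands in the `K`-algebra `L`:
`∏ j, x j = ∑ i, (∏ j, a i j (x j)) • c i` for all `x`, with linear forms `a i j` on `L`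
and elements `c i` of `L`. -/
def HasMultilinearAlgorithm (K L : Type*) [Field K] [Field L] [Algebra K L] (k s : ℕ) : Prop :=
  ∃ (a : Fin s → Fin k → Module.Dual K L) (c : Fin s → L),
    ∀ x : Fin k → L, ∏ j, x j = ∑ i, (∏ j, a i j (x j)) • c i

/-- Multilinear multiplication algorithms exist. -/
theorem exists_hasMultilinearAlgorithm (K L : Type*) [Field K] [Field L] [Algebra K L]
    [FiniteDimensional K L] (k : ℕ) : ∃ s, HasMultilinearAlgorithm K L k s := by
  let b := Module.finBasis K L
  let e := Fintype.equivFin (Fin k → Fin (Module.finrank K L))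
  refine ⟨_, fun i j => b.coord (e.symm i j), fun i => ∏ j, b (e.symm i j), fun x => ?_⟩
  rw [e.symm.sum_comp (fun f => (∏ j, b.coord (f j) (x j)) • ∏ j, b (f j))]
  conv_lhs => enter [2, j]; rw [← b.sum_repr (x j)]
  rw [Finset.prod_univ_sum, Fintype.piFinset_univ]
  refine Finset.sum_congr rfl fun f _ => ?_
  simp [Algebra.smul_def, Finset.prod_mul_distrib, map_prod]

/-- The `k`-multilinear complexity `μ_{q,k}(n)` of the multiplication of `k` elements
in `𝔽_{q^n}` over `K = 𝔽_q`. -/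
def multilinearComplexity (K : Type*) [Field K] (k n : ℕ) : ℕ :=
  sInf {s | HasMultilinearAlgorithm K (FiniteExt K n) k s}

/-- The input quantities available for free to a computation of the product of `k` elements
of `L`: the linear forms in (the coordinates of) a single argument, as functions of the
`k` arguments. -/
def inputForms (K L : Type*) [Field K] [Field L] [Algebra K L] (k : ℕ) :
    Set ((Fin k → L) → K) :=
  {f | ∃ (j : Fin k) (φ : Module.Dual K L), f = fun x => φ (x j)}

/-- The product of `k` elements of `L` can be computed with `s` non-scalar (bilinear)
multiplications in `K`, where additions and multiplications by constants of `K` are free: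
the `t`-th multiplication is the product `w t` of two quantities, each a linear combination of
inputs and of results of earlier multiplications, and all coordinates of the product of the
`k` elements are linear combinations of inputs and of the results `w t`. -/
def HasBilinearComputation (K L : Type*) [Field K] [Field L] [Algebra K L] (k s : ℕ) : Prop :=
  ∃ w : Fin s → (Fin k → L) → K,
    (∀ t : Fin s,
      ∃ u ∈ Submodule.span K (inputForms K L k ∪ w '' {t' | t' < t}),
      ∃ v ∈ Submodule.span K (inputForms K L k ∪ w '' {t' | t' < t}), w t = u * v) ∧
    ∀ φ : Module.Dual K L,
      (fun x => φ (∏ j, x j)) ∈ Submodule.span K (inputForms K L k ∪ Set.range w)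

/-- The minimal number `ν_{q,k}(n)` of bilinear multiplications in `K = 𝔽_q` required to
compute the product of `k` elements of `𝔽_{q^n}`. -/
def bilinearComplexity (K : Type*) [Field K] (k n : ℕ) : ℕ :=
  sInf {s | HasBilinearComputation K (FiniteExt K n) k s}

/-! ### Places, divisors, Riemann-Roch spaces and the genus of a function field -/

/-- A place of the function field `F / K`, given by its valuation ring: a discrete valuation ring
containing `K`, with fraction field `F`. -/
structure Place (K F : Type*) [Field K] [Field F] [Algebra K F] where
  /-- The valuation ring of the place. -/
  ring : Subalgebra K F
  isFractionRing : IsFractionRing ring F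
  isDiscreteValuationRing : IsDiscreteValuationRing ring

namespace Place

variable {K F : Type*} [Field K] [Field F] [Algebra K F]

attribute [instance] Place.isFractionRing Place.isDiscreteValuationRing

/-- The degree of a place: the degree over `K` of its residue class field. -/
def degree (P : Place K F) : ℕ :=
  Module.finrank K (IsLocalRing.ResidueField P.ring)

/-- The normalized discrete valuation of a place, written multiplicatively:
`P.valuation f = exp (- v_P(f))` for `f ≠ 0`, and `P.valuation 0 = 0`. -/
def valuation (P : Place K F) : Valuation F ℤᵐ⁰ :=
  (IsDiscreteValuationRing.maximalIdeal P.ring).valuation F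

/-- Constants have nonnegative order at every place. -/
theorem valuation_algebraMap_le_one (P : Place K F) (c : K) :
    P.valuation (algebraMap K F c) ≤ 1 :=
  (IsDiscreteValuationRing.maximalIdeal P.ring).valuation_le_one (algebraMap K P.ring c)

end Place

/-- Divisors of `F / K`: finite formal integral combinations of places. -/
abbrev FunctionFieldDivisor (K F : Type*) [Field K] [Field F] [Algebra K F] : Type _ :=
  Place K F →₀ ℤ

namespace FunctionFieldDivisor

variable {K F : Type*} [Field K] [Field F] [Algebra K F]

/-- The degree of a divisor. -/
def degree (D : FunctionFieldDivisor K F) : ℤ :=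
  D.sum fun P m => m * (P.degree : ℤ)

/-- The Riemann-Roch space `ℒ(D)`: the functions `f` that are `0` or satisfy
`v_P(f) ≥ -D(P)` at every place `P`. -/
def riemannRochSpace (D : FunctionFieldDivisor K F) : Submodule K F where
  carrier := {f | ∀ P : Place K F, P.valuation f ≤ WithZero.exp (D P)}
  zero_mem' := fun P => by simp
  add_mem' := fun {f g} hf hg P =>
    (P.valuation.map_add f g).trans (max_le (hf P) (hg P))
  smul_mem' := fun c f hf P => by
    rw [Algebra.smul_def, map_mul]
    exact (mul_le_mul' (P.valuation_algebraMap_le_one c) (hf P)).trans_eq (one_mul _)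

/-- The dimension `ℓ(D)` of the Riemann-Roch space over `K`. -/
def dim (D : FunctionFieldDivisor K F) : ℕ :=
  Module.finrank K D.riemannRochSpace

end FunctionFieldDivisor

/-- The genus of the function field `F / K`: the maximum of `deg A - ℓ(A) + 1` over all
divisors `A`. -/
def functionFieldGenus (K F : Type*) [Field K] [Field F] [Algebra K F] : ℤ :=
  sSup (Set.range fun A : FunctionFieldDivisor K F => A.degree - (A.dim : ℤ) + 1)

/-- A divisor `D` is non-special if its index of speciality `ℓ(D) - deg D + g - 1` vanishes. -/
def FunctionFieldDivisor.IsNonspecial {K F : Type*} [Field K] [Field F] [Algebra K F]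
    (D : FunctionFieldDivisor K F) : Prop :=
  (D.dim : ℤ) - D.degree + functionFieldGenus K F - 1 = 0

end

noncomputable section

/-! ### Valuations of places -/

namespace Place

variable {K F : Type*} [Field K] [Field F] [Algebra K F]

/-! This is interpolation on a curve. Let `Q` be the place of degree `n` and `D = R + Q`.
Non-speciality and `deg R = g - 1` give `ℓ(R) = 0`, so taking leading coefficients at `Q` is
injective on `ℒ(D)`. Riemann's inequality gives `ℓ(D) ≥ n`, so this map is a bijection onto the
residue field, a copy of `𝔽_{q^n}` (`leadingCoeff_surjective_of_isNonspecial`). Lift each `x_j` to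
`f_j ∈ ℒ(D)`. The product of the `f_j` lies in `ℒ(kD)`, and it is determined by its leading
coefficients at a set `S` of places as soon as the degrees in `S` add up to more than `deg kD = kn +
kg - k`: a difference lies in a Riemann-Roch space of negative degree. Leading coefficients are
multiplicative, so `∏ x_j` depends linearly on products in the residue fields of `S`
(`hasInterpolation`). They replace values, so `D` may meet `S` and `Q`.

Multilinear algorithms in the residue fields then add up to the first bound. For the other two, `S`
is thinned to `T` with total degree at most `kn + kg - k + r`, and each place of degree `i` costs at
most `i` times the supremum. For `ν`, a residue-field product of `k` factors is computed by `k - 1`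
bilinear multiplications.

The genus is a supremum in `ℤ`, so Riemann's theorem is needed to know that it bounds anything. Its
proof, and that of `degree_principal`, compares the inequality `∑ e f ≤ [F : K(y)]`, obtained from
weak approximation, with an explicit lower bound for `ℓ(lB + C)`, where `B` is a divisor of poles.
Nowhere is `K` assumed algebraically closed in `F`. -/

theorem mem_ring_iff (P : Place K F) {f : F} : f ∈ P.ring ↔ P.valuation f ≤ 1 := by
  refine ⟨fun h => (IsDiscreteValuationRing.maximalIdeal P.ring).valuation_le_one ⟨f, h⟩,
    fun h => ?_⟩
  obtain ⟨a, rfl⟩ := IsDiscreteValuationRing.exists_lift_of_le_one (A := P.ring) (K := F) h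
  exact a.2

theorem mem_maximalIdeal_iff (P : Place K F) (a : P.ring) :
    a ∈ IsLocalRing.maximalIdeal P.ring ↔ P.valuation (a : F) < 1 :=
  ((IsDiscreteValuationRing.maximalIdeal P.ring).valuation_lt_one_iff_mem (K := F) a).symm

theorem residue_eq_zero_iff (P : Place K F) (a : P.ring) :
    IsLocalRing.residue P.ring a = 0 ↔ P.valuation (a : F) < 1 := by
  rw [IsLocalRing.residue_eq_zero_iff, mem_maximalIdeal_iff]

theorem ring_injective : Function.Injective (Place.ring : Place K F → Subalgebra K F) := by
  rintro ⟨R, _, _⟩ ⟨R', _, _⟩ h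
  cases h
  rfl

theorem exists_uniformizer (P : Place K F) : ∃ t : F, P.valuation t = WithZero.exp (-1) :=
  (IsDiscreteValuationRing.maximalIdeal P.ring).valuation_exists_uniformizer F

/-- A uniformizer of the place `P`. -/
def uniformizer (P : Place K F) : F := P.exists_uniformizer.choose

@[simp]
theorem valuation_uniformizer (P : Place K F) : P.valuation P.uniformizer = WithZero.exp (-1) :=
  P.exists_uniformizer.choose_spec

@[simp]
theorem valuation_uniformizer_zpow (P : Place K F) (m : ℤ) :
    P.valuation (P.uniformizer ^ m) = WithZero.exp (-m) := by
  rw [map_zpow₀, valuation_uniformizer, ← WithZero.exp_zsmul]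
  simp

theorem uniformizer_ne_zero (P : Place K F) : P.uniformizer ≠ 0 := fun h => by
  have := P.valuation_uniformizer
  rw [h, map_zero] at this
  exact WithZero.exp_ne_zero this.symm

theorem exists_valuation_eq_exp (P : Place K F) {f : F} (hf : f ≠ 0) :
    ∃ m : ℤ, P.valuation f = WithZero.exp m :=
  ⟨_, (WithZero.exp_log ((P.valuation.ne_zero_iff).2 hf)).symm⟩

/-- The valuation ring of a place is not contained in that of another place. -/
theorem exists_valuation_le_one_of_ne {P P' : Place K F} (h : P ≠ P') :
    ∃ f, P.valuation f ≤ 1 ∧ 1 < P'.valuation f := by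
  by_contra! H
  have hle : P.ring ≤ P'.ring := fun f hf => P'.mem_ring_iff.2 (H f (P.mem_ring_iff.1 hf))
  refine h (ring_injective (le_antisymm hle fun a ha => ?_))
  by_contra hna
  rw [mem_ring_iff, not_le] at hna
  have ha0 : a ≠ 0 := by rintro rfl; simp at hna
  -- An element `a` of the larger ring with a pole at `P` makes that ring all of `F`: a high power
  -- of `a⁻¹` carries any `f` into the ring of `P`. A place has a proper valuation ring, whence the
  -- contradiction.
  have key : ∀ f : F, P'.valuation f ≤ 1 := fun f => by
    by_cases hf0 : f = 0
    · simp [hf0]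
    obtain ⟨x, hx⟩ := P.exists_valuation_eq_exp hf0
    obtain ⟨y, hy⟩ := P.exists_valuation_eq_exp ha0
    have hy0 : 0 < y := by rwa [hy, ← WithZero.exp_zero, WithZero.exp_lt_exp] at hna
    have h1 : P'.valuation (f * a⁻¹ ^ x.toNat) ≤ 1 := H _ (by
      rw [map_mul, map_pow, map_inv₀, hx, hy, ← WithZero.exp_neg, ← WithZero.exp_nsmul,
        ← WithZero.exp_add, ← WithZero.exp_zero, WithZero.exp_le_exp]
      have : x ≤ x.toNat := Int.self_le_toNat x
      simp only [nsmul_eq_mul]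
      nlinarith)
    have h2 : f = f * a⁻¹ ^ x.toNat * a ^ x.toNat := by
      rw [mul_assoc, ← mul_pow, inv_mul_cancel₀ ha0, one_pow, mul_one]
    rw [h2, map_mul, map_pow]
    exact mul_le_one' h1 (pow_le_one' (P'.mem_ring_iff.1 ha) _)
  have := key (P'.uniformizer ^ (-1 : ℤ))
  rw [valuation_uniformizer_zpow, ← WithZero.exp_zero, WithZero.exp_le_exp] at this
  omega

/-! ### Order filtration and leading coefficients -/

/-- The functions of order at least `-m` at the place `P`. -/
def filtration (P : Place K F) (m : ℤ) : Submodule K F where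
  carrier := {f | P.valuation f ≤ WithZero.exp m}
  zero_mem' := by simp
  add_mem' := fun {f g} hf hg => (P.valuation.map_add f g).trans (max_le hf hg)
  smul_mem' := fun c f hf => by
    rw [Algebra.smul_def]
    refine (P.valuation.map_mul _ _).trans_le ?_
    exact (mul_le_mul' (P.valuation_algebraMap_le_one c) hf).trans_eq (one_mul _)

theorem mem_filtration {P : Place K F} {m : ℤ} {f : F} :
    f ∈ P.filtration m ↔ P.valuation f ≤ WithZero.exp m := Iff.rfl

theorem filtration_mono (P : Place K F) : Monotone P.filtration := fun _ _ h _ hf =>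
  le_trans hf (WithZero.exp_le_exp.2 h)

theorem uniformizer_zpow_mul_mem {P : Place K F} {m : ℤ} {f : F} (hf : f ∈ P.filtration m) :
    P.uniformizer ^ m * f ∈ P.ring := by
  rw [mem_ring_iff, map_mul, valuation_uniformizer_zpow]
  refine (mul_le_mul' le_rfl (mem_filtration.1 hf)).trans_eq ?_
  rw [← WithZero.exp_add]
  simp

/-- The leading coefficient at `P` of a function of order at least `-m`: the residue of its product
with the `m`-th power of the uniformizer. -/
def leadingCoeff (P : Place K F) (m : ℤ) :
    P.filtration m →ₗ[K] IsLocalRing.ResidueField P.ring :=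
  (IsScalarTower.toAlgHom K P.ring (IsLocalRing.ResidueField P.ring)).toLinearMap ∘ₗ
    ((LinearMap.mulLeft K (P.uniformizer ^ m) ∘ₗ (P.filtration m).subtype).codRestrict
      P.ring.toSubmodule fun f => uniformizer_zpow_mul_mem f.2)

theorem leadingCoeff_apply (P : Place K F) {m : ℤ} (f : P.filtration m) :
    P.leadingCoeff m f =
      IsLocalRing.residue P.ring ⟨P.uniformizer ^ m * f, uniformizer_zpow_mul_mem f.2⟩ := rfl

theorem leadingCoeff_eq_zero_iff (P : Place K F) {m : ℤ} (f : P.filtration m) :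
    P.leadingCoeff m f = 0 ↔ (f : F) ∈ P.filtration (m - 1) := by
  rw [leadingCoeff_apply, residue_eq_zero_iff, mem_filtration]
  simp only [map_mul, valuation_uniformizer_zpow]
  by_cases hf0 : (f : F) = 0
  · simp [hf0]
  · obtain ⟨x, hx⟩ := P.exists_valuation_eq_exp hf0
    rw [hx, ← WithZero.exp_add, ← WithZero.exp_zero, WithZero.exp_lt_exp, WithZero.exp_le_exp]
    omega

theorem leadingCoeff_surjective (P : Place K F) (m : ℤ) :
    Function.Surjective (P.leadingCoeff m) := fun a => by
  obtain ⟨a, rfl⟩ := IsLocalRing.residue_surjective a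
  have hmem : P.uniformizer ^ (-m) * (a : F) ∈ P.filtration m := by
    rw [mem_filtration, map_mul, valuation_uniformizer_zpow, neg_neg]
    exact (mul_le_mul' le_rfl (P.mem_ring_iff.1 a.2)).trans_eq (mul_one _)
  refine ⟨⟨_, hmem⟩, ?_⟩
  rw [leadingCoeff_apply]
  congr 1
  ext
  simp only
  rw [← mul_assoc, ← zpow_add₀ P.uniformizer_ne_zero, add_neg_cancel, zpow_zero, one_mul]

theorem prod_mem_filtration (P : Place K F) {k : ℕ} {m : ℤ} {f : Fin k → F}
    (hf : ∀ j, f j ∈ P.filtration m) : ∏ j, f j ∈ P.filtration (k * m) := by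
  rw [mem_filtration, map_prod]
  refine (Finset.prod_le_prod' fun j _ => mem_filtration.1 (hf j)).trans_eq ?_
  rw [Finset.prod_const, ← WithZero.exp_nsmul]
  simp

/-- One uniformizer is fixed for all orders, so its power of exponent `k * m` distributes evenly
over the `k` factors. -/
theorem leadingCoeff_prod (P : Place K F) {k : ℕ} {m : ℤ} (f : Fin k → P.filtration m) :
    P.leadingCoeff (k * m) ⟨∏ j, (f j : F), P.prod_mem_filtration fun j => (f j).2⟩ =
      ∏ j, P.leadingCoeff m (f j) := by
  simp only [leadingCoeff_apply, ← map_prod]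
  congr 1
  ext
  simp only [SubmonoidClass.coe_finsetProd, Finset.prod_mul_distrib, Finset.prod_const,
    Finset.card_univ, Fintype.card_fin]
  rw [mul_comm (k : ℤ) m, zpow_mul, zpow_natCast]

end Place

end

noncomputable section

/-! ### Weak approximation -/

theorem WithZero.exists_forall_pow_mul_lt {a b c : ℤᵐ⁰} (ha : a < 1) (hc : c ≠ 0) :
    ∃ N : ℕ, ∀ n ≥ N, a ^ n * b < c := by
  induction a using WithZero.expRecOn with
  | zero =>
    refine ⟨1, fun n hn => ?_⟩
    rw [zero_pow (by omega), zero_mul]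
    exact zero_lt_iff.2 hc
  | exp x =>
    induction b using WithZero.expRecOn with
    | zero => exact ⟨0, fun n _ => by rw [mul_zero]; exact zero_lt_iff.2 hc⟩
    | exp y =>
      induction c using WithZero.expRecOn with
      | zero => exact absurd rfl hc
      | exp u =>
        rw [← WithZero.exp_zero, WithZero.exp_lt_exp] at ha
        refine ⟨(y - u + 1).toNat, fun n hn => ?_⟩
        rw [← WithZero.exp_nsmul, ← WithZero.exp_add, WithZero.exp_lt_exp, nsmul_eq_mul]
        have : y - u + 1 ≤ (n : ℤ) := by omega
        nlinarith

namespace Place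

variable {K F : Type*} [Field K] [Field F] [Algebra K F]

/-- Neither valuation ring contains the other; the quotient of one witness by the other works. -/
theorem exists_one_lt_lt_one {P P' : Place K F} (h : P ≠ P') :
    ∃ z, 1 < P.valuation z ∧ P'.valuation z < 1 := by
  obtain ⟨a, ha', ha⟩ := exists_valuation_le_one_of_ne h.symm
  obtain ⟨b, hb, hb'⟩ := exists_valuation_le_one_of_ne h
  have hb0 : b ≠ 0 := by rintro rfl; simp at hb'
  refine ⟨a / b, ?_, ?_⟩
  · rw [map_div₀, one_lt_div₀ (zero_lt_iff.2 ((P.valuation.ne_zero_iff).2 hb0))]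
    exact hb.trans_lt ha
  · rw [map_div₀, div_lt_one₀ (zero_lt_one.trans hb')]
    exact ha'.trans_lt hb'

theorem exists_forall_lt_one (P : Place K F) (S : Finset (Place K F)) (hP : P ∉ S) :
    ∃ w, 1 < P.valuation w ∧ ∀ P' ∈ S, P'.valuation w < 1 := by
  classical
  induction S using Finset.induction_on with
  | empty =>
    refine ⟨P.uniformizer ^ (-1 : ℤ), ?_, by simp⟩
    rw [valuation_uniformizer_zpow, ← WithZero.exp_zero, WithZero.exp_lt_exp]
    norm_num
  | insert P' S hP' ih =>
    rw [Finset.mem_insert, not_or] at hP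
    obtain ⟨w, hw, hwS⟩ := ih hP.2
    obtain ⟨z, hz, hz'⟩ := exists_one_lt_lt_one hP.1
    have hex : ∀ Q : Place K F, ∃ N : ℕ, Q ∈ S →
        ∀ n ≥ N, Q.valuation w ^ n * Q.valuation z < 1 := fun Q => by
      by_cases hQ : Q ∈ S
      · obtain ⟨N, hN⟩ := WithZero.exists_forall_pow_mul_lt (b := Q.valuation z) (hwS Q hQ)
          one_ne_zero
        exact ⟨N, fun _ => hN⟩
      · exact ⟨0, fun h => absurd h hQ⟩
    choose N hN using hex
    set r := S.sup N + 1
    have hr : ∀ Q ∈ S, Q.valuation w ^ r * Q.valuation z < 1 := fun Q hQ =>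
      hN Q hQ r ((Finset.le_sup hQ).trans (Nat.le_succ _))
    -- If `w` has no pole at `P'`, a power of `w` times `z` suffices. Otherwise the power is
    -- replaced by `w ^ r / (1 + w ^ r)`, which is a unit at the poles of `w` and still small on
    -- `S`.
    rcases le_or_gt (P'.valuation w) 1 with h | h
    · refine ⟨w ^ r * z, ?_, fun Q hQ => ?_⟩
      · rw [map_mul, map_pow]
        exact hz.trans_le (le_mul_of_one_le_left' (one_le_pow₀ hw.le))
      · rw [map_mul, map_pow]
        rcases Finset.mem_insert.1 hQ with rfl | hQ
        · exact (mul_le_of_le_one_left' (pow_le_one' h _)).trans_lt hz'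
        · exact hr Q hQ
    · have hbig : ∀ Q : Place K F, 1 < Q.valuation w → Q.valuation (w ^ r / (1 + w ^ r)) = 1 := by
        intro Q hQ
        have h1 : 1 < Q.valuation (w ^ r) := by
          rw [map_pow]; exact one_lt_pow₀ hQ (Nat.succ_ne_zero _)
        rw [map_div₀, Q.valuation.map_add_eq_of_lt_right (by rwa [map_one]), div_self]
        exact (zero_lt_one.trans h1).ne'
      refine ⟨w ^ r / (1 + w ^ r) * z, ?_, fun Q hQ => ?_⟩
      · rwa [map_mul, hbig P hw, one_mul]
      · rcases Finset.mem_insert.1 hQ with rfl | hQ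
        · rwa [map_mul, hbig Q h, one_mul]
        · have h1 : Q.valuation (w ^ r) < 1 := by
            rw [map_pow]; exact pow_lt_one₀ zero_le (hwS Q hQ) (Nat.succ_ne_zero _)
          rw [map_mul, map_div₀, Q.valuation.map_one_add_of_lt h1, div_one, map_pow]
          exact hr Q hQ

/-- Weak approximation: there are functions arbitrarily close to `1` at one place and to `0`
at finitely many others. -/
theorem exists_sub_one_lt_one (P : Place K F) (S : Finset (Place K F)) (hP : P ∉ S)
    (m : Place K F → ℤ) :
    ∃ u, P.valuation (u - 1) < 1 ∧ ∀ P' ∈ S, P'.valuation u ≤ WithZero.exp (m P') := by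
  obtain ⟨w, hw, hwS⟩ := exists_forall_lt_one P S hP
  have hex : ∀ Q : Place K F, ∃ N : ℕ, Q ∈ S →
      ∀ n ≥ N, Q.valuation w ^ n * 1 < WithZero.exp (m Q) := fun Q => by
    by_cases hQ : Q ∈ S
    · obtain ⟨N, hN⟩ := WithZero.exists_forall_pow_mul_lt (b := 1) (c := WithZero.exp (m Q))
        (hwS Q hQ) WithZero.exp_ne_zero
      exact ⟨N, fun _ => hN⟩
    · exact ⟨0, fun h => absurd h hQ⟩
  choose N hN using hex
  set r := S.sup N + 1
  have h1 : 1 < P.valuation (w ^ r) := by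
    rw [map_pow]; exact one_lt_pow₀ hw (Nat.succ_ne_zero _)
  have h2 : P.valuation (1 + w ^ r) = P.valuation (w ^ r) :=
    P.valuation.map_add_eq_of_lt_right (by rwa [map_one])
  refine ⟨w ^ r / (1 + w ^ r), ?_, fun Q hQ => ?_⟩
  · have h0 : 1 + w ^ r ≠ 0 := by
      rw [← P.valuation.ne_zero_iff, h2]
      exact (zero_lt_one.trans h1).ne'
    have : w ^ r / (1 + w ^ r) - 1 = -(1 / (1 + w ^ r)) := by field_simp; ring
    rw [this, Valuation.map_neg, map_div₀, map_one, h2, div_lt_one₀ (zero_lt_one.trans h1)]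
    exact h1
  · have h1 : Q.valuation (w ^ r) < 1 := by
      rw [map_pow]; exact pow_lt_one₀ zero_le (hwS Q hQ) (Nat.succ_ne_zero _)
    rw [map_div₀, Q.valuation.map_one_add_of_lt h1, div_one, map_pow]
    simpa using (hN Q hQ r ((Finset.le_sup hQ).trans (Nat.le_succ _))).le

/-- A discrete valuation ring is integrally closed, and this one contains `K`. -/
theorem valuation_le_one_of_isAlgebraic (P : Place K F) {f : F} (hf : IsAlgebraic K f) :
    P.valuation f ≤ 1 := by
  rw [← mem_ring_iff]
  obtain ⟨y, hy⟩ := (IsIntegrallyClosed.isIntegral_iff (R := P.ring) (K := F)).1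
    (hf.isIntegral.tower_top (A := P.ring))
  rw [← hy]
  exact y.2

theorem transcendental_of_valuation_lt_one (P : Place K F) {f : F} (hf0 : f ≠ 0)
    (hf : P.valuation f < 1) : Transcendental K f := fun h => by
  have h1 := P.valuation_le_one_of_isAlgebraic h.inv
  rw [map_inv₀, inv_le_one₀ (zero_lt_iff.2 ((P.valuation.ne_zero_iff).2 hf0))] at h1
  exact absurd hf (not_lt.2 h1)

end Place

/-! ### The fundamental inequality -/

open IntermediateField

section

variable {K F : Type*} [Field K] [Field F] [Algebra K F]

theorem Submodule.linearIndependent_mkQ_iff {R V : Type*} [Ring R] [AddCommGroup V] [Module R V]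
    {U : Submodule R V} {ι : Type*} [Fintype ι] {z : ι → V} :
    LinearIndependent R (fun i => U.mkQ (z i)) ↔
      ∀ c : ι → R, ∑ i, c i • z i ∈ U → ∀ i, c i = 0 := by
  rw [Fintype.linearIndependent_iff]
  refine forall_congr' fun c => ?_
  rw [← Submodule.Quotient.mk_eq_zero U, ← Submodule.mkQ_apply, map_sum]
  simp only [map_smul]

theorem Submodule.linearIndependent_mkQ_sumElim {K V : Type*} [Field K] [AddCommGroup V]
    [Module K V]
    {U M : Submodule K V} (hUM : U ≤ M) {ι κ : Type*} [Fintype ι] [Fintype κ]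
    {z : ι → V} {w : κ → V}
    (hzM : ∀ i, z i ∈ M) (hz : LinearIndependent K fun i => U.mkQ (z i))
    (hw : LinearIndependent K fun i => M.mkQ (w i)) :
    LinearIndependent K fun i => U.mkQ (Sum.elim z w i) := by
  rw [Submodule.linearIndependent_mkQ_iff] at *
  intro c hc
  rw [Fintype.sum_sum_type] at hc
  simp only [Sum.elim_inl, Sum.elim_inr] at hc
  have h2 : ∀ i, c (Sum.inr i) = 0 := hw (fun i => c (Sum.inr i)) (by
    have hm : ∑ i, c (Sum.inl i) • z i ∈ M := M.sum_mem fun i _ => M.smul_mem _ (hzM i)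
    exact (M.add_mem_iff_right hm).1 (hUM hc))
  have h1 : ∀ i, c (Sum.inl i) = 0 := hz (fun i => c (Sum.inl i)) (by simpa [h2] using hc)
  rintro (i | i)
  exacts [h1 i, h2 i]

/-- If multiplication by `y` maps `M` into `U ≤ M`, then families in `M` that are linearly
independent modulo `U` are linearly independent over `K[y]`. -/
theorem linearIndependent_adjoin_of_linearIndependent_mkQ {y : F} (hy : y ≠ 0)
    {M U : Submodule K F} (hUM : U ≤ M) (hyM : ∀ f ∈ M, y * f ∈ U) {ι : Type*} [Fintype ι]
    {z : ι → F} (hz : ∀ i, z i ∈ M) (hli : LinearIndependent K fun i => U.mkQ (z i)) :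
    LinearIndependent (Algebra.adjoin K {y}) z := by
  have hpow : ∀ p : K[X], ∀ f ∈ M, Polynomial.aeval y p * f ∈ M := fun p => by
    induction p using Polynomial.induction_on' with
    | add p q hp hq =>
      intro f hf
      rw [map_add, add_mul]
      exact M.add_mem (hp f hf) (hq f hf)
    | monomial n a =>
      intro f hf
      rw [Polynomial.aeval_monomial, mul_assoc, ← Algebra.smul_def]
      refine M.smul_mem _ ?_
      induction n with
      | zero => simpa
      | succ n ih =>
        rw [pow_succ', mul_assoc]
        exact hUM (hyM _ ih)
  -- Modulo `U` only the constant coefficients of a relation survive, so they vanish; divide by `y`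
  -- and repeat with smaller degrees.
  have key : ∀ n : ℕ, ∀ p : ι → K[X], (∀ i, (p i).natDegree < n) →
      ∑ i, Polynomial.aeval y (p i) * z i = 0 → ∀ i, p i = 0 := by
    intro n
    induction n with
    | zero => intro p hp _ i; exact absurd (hp i) (Nat.not_lt_zero _)
    | succ n ih =>
      intro p hp h0
      have hsplit : ∀ i, Polynomial.aeval y (p i) * z i =
          y * (Polynomial.aeval y (p i).divX * z i) + (p i).coeff 0 • z i := fun i => by
        conv_lhs => rw [← Polynomial.divX_mul_X_add (p i)]
        rw [map_add, map_mul, Polynomial.aeval_X, Polynomial.aeval_C, Algebra.smul_def]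
        ring
      simp only [hsplit, Finset.sum_add_distrib, ← Finset.mul_sum] at h0
      have hmem : ∑ i, Polynomial.aeval y (p i).divX * z i ∈ M :=
        M.sum_mem fun i _ => hpow _ _ (hz i)
      have hU : ∑ i, (p i).coeff 0 • z i ∈ U := by
        rw [eq_neg_of_add_eq_zero_right h0]
        exact U.neg_mem (hyM _ hmem)
      have hc : ∀ i, (p i).coeff 0 = 0 := by
        exact Submodule.linearIndependent_mkQ_iff.1 hli _ hU
      have h1 : ∑ i, Polynomial.aeval y (p i).divX * z i = 0 := by
        simpa [hc, hy] using h0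
      have h2 : ∀ i, (p i).divX = 0 := by
        -- For constants the induction hypothesis is useless, since no degree is `< 0`; but then
        -- `divX` is zero outright.
        by_cases hn : n = 0
        · intro i
          have : (p i).natDegree = 0 := by have := hp i; omega
          rw [Polynomial.eq_C_of_natDegree_eq_zero this, Polynomial.divX_C]
        · refine ih _ (fun i => ?_) h1
          rw [Polynomial.natDegree_divX_eq_natDegree_tsub_one]
          have := hp i
          omega
      intro i
      rw [← Polynomial.divX_mul_X_add (p i), h2, hc]
      simp
  rw [Fintype.linearIndependent_iff]
  intro c hc
  have hex : ∀ i, ∃ p : K[X], Polynomial.aeval y p = (c i : F) := fun i => by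
    obtain ⟨p, hp⟩ := (Algebra.adjoin_singleton_eq_range_aeval K y).le (c i).2
    exact ⟨p, hp⟩
  choose p hp using hex
  intro i
  ext
  rw [← hp, key ((Finset.univ.sup fun i => (p i).natDegree) + 1) p
    (fun i => Nat.lt_succ_of_le (Finset.le_sup (f := fun i => (p i).natDegree) (Finset.mem_univ i)))
    (by simpa [hp, Algebra.smul_def] using hc) i]
  simp

/-- Independence over `K[y]` passes to its fraction field `K(y)`. -/
theorem card_le_finrank_of_linearIndependent_mkQ {y : F} (hy : y ≠ 0)
    [FiniteDimensional K⟮y⟯ F]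
    {M U : Submodule K F} (hUM : U ≤ M) (hyM : ∀ f ∈ M, y * f ∈ U) {ι : Type*} [Fintype ι]
    {z : ι → F} (hz : ∀ i, z i ∈ M) (hli : LinearIndependent K fun i => U.mkQ (z i)) :
    Fintype.card ι ≤ Module.finrank K⟮y⟯ F := by
  have := linearIndependent_adjoin_of_linearIndependent_mkQ hy hUM hyM hz hli
  open scoped IntermediateField.algebraAdjoinAdjoin in
  exact ((LinearIndependent.iff_fractionRing (Algebra.adjoin K {y}) K⟮y⟯).1
    this).fintype_card_le_finrank

end

namespace Place

variable {K F : Type*} [Field K] [Field F] [Algebra K F]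

/-- The functions of order at least `-m P` at every place `P` in `S`. -/
def localModule (S : Finset (Place K F)) (m : Place K F → ℤ) : Submodule K F :=
  ⨅ P ∈ S, P.filtration (m P)

theorem mem_localModule {S : Finset (Place K F)} {m : Place K F → ℤ} {f : F} :
    f ∈ localModule S m ↔ ∀ P ∈ S, P.valuation f ≤ WithZero.exp (m P) := by
  simp [localModule, mem_filtration]

theorem localModule_mono (S : Finset (Place K F)) : Monotone (localModule S) :=
  fun _ _ h _ hf => mem_localModule.2 fun P hP =>
    (mem_localModule.1 hf P hP).trans (WithZero.exp_le_exp.2 (h P))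

theorem exists_leadingCoeff_eq {S : Finset (Place K F)} {P : Place K F} (hP : P ∈ S)
    (m : Place K F → ℤ) (a : IsLocalRing.ResidueField P.ring) :
    ∃ f ∈ localModule S m, ∃ hf : f ∈ P.filtration (m P), P.leadingCoeff (m P) ⟨f, hf⟩ = a := by
  classical
  obtain ⟨⟨b, hb⟩, hba⟩ := P.leadingCoeff_surjective (m P) a
  by_cases hb0 : b = 0
  · refine ⟨0, zero_mem _, zero_mem _, ?_⟩
    rw [← hba]
    congr 2
    exact hb0.symm
  have hlog : ∀ Q : Place K F, Q.valuation b = WithZero.exp (WithZero.log (Q.valuation b)) :=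
    fun Q => (WithZero.exp_log ((Q.valuation.ne_zero_iff).2 hb0)).symm
  -- Multiplying `b` by `u` keeps its leading coefficient at `P` and forces the required order at
  -- the other places of `S`.
  obtain ⟨u, hu, huS⟩ := exists_sub_one_lt_one P (S.erase P) (Finset.notMem_erase P S)
    fun Q => m Q - WithZero.log (Q.valuation b)
  have hu1 : P.valuation u = 1 := by
    have := P.valuation.map_one_add_of_lt hu
    rwa [add_sub_cancel] at this
  have hPub : u * b ∈ P.filtration (m P) := by
    rw [mem_filtration, map_mul, hu1, one_mul]
    exact hb
  refine ⟨u * b, mem_localModule.2 fun Q hQ => ?_, hPub, ?_⟩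
  · by_cases hQP : Q = P
    · subst hQP; exact hPub
    · rw [map_mul]
      refine (mul_le_mul' (huS Q (Finset.mem_erase.2 ⟨hQP, hQ⟩)) le_rfl).trans_eq ?_
      rw [hlog, ← WithZero.exp_add, WithZero.log_exp, sub_add_cancel]
  · rw [← hba, ← sub_eq_zero, ← map_sub, leadingCoeff_eq_zero_iff, mem_filtration]
    have : u * b - b = (u - 1) * b := by ring
    simp only [AddSubgroupClass.coe_sub, this, map_mul]
    have hb' := mem_filtration.1 hb
    by_cases hu0 : u - 1 = 0
    · simp [hu0]
    obtain ⟨x, hx⟩ := P.exists_valuation_eq_exp hu0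
    rw [hlog, WithZero.exp_le_exp] at hb'
    rw [hx, ← WithZero.exp_zero, WithZero.exp_lt_exp] at hu
    rw [hx, hlog, ← WithZero.exp_add, WithZero.exp_le_exp]
    omega

/-- Relaxing the order condition at `P` by one adds `d P` functions, whose leading coefficients at
`P` are independent. The sizes `d P` of independent families stand in for degrees because residue
fields are not yet known to be finite-dimensional. -/
theorem exists_linearIndependent_mkQ (S : Finset (Place K F)) (d : Place K F → ℕ)
    (hdS : ∀ P, P ∉ S → d P = 0)
    (hd : ∀ P ∈ S, ∃ a : Fin (d P) → IsLocalRing.ResidueField P.ring, LinearIndependent K a)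
    (E : Place K F →₀ ℕ) (m : Place K F → ℤ) :
    ∃ (ι : Type) (_ : Fintype ι) (z : ι → F), Fintype.card ι = E.sum (fun P e => e * d P) ∧
      (∀ i, z i ∈ localModule S (m + fun P => (E P : ℤ))) ∧
      LinearIndependent K fun i => (localModule S m).mkQ (z i) := by
  classical
  induction E using Finsupp.induction_linear generalizing m with
  | zero =>
    exact ⟨Empty, inferInstance, Empty.elim, by simp, by simp, linearIndependent_empty_type⟩
  | add E E' h h' =>
    obtain ⟨ι, _, z, hc, hz, hli⟩ := h m
    obtain ⟨ι', _, z', hc', hz', hli'⟩ := h' (m + fun P => (E P : ℤ))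
    refine ⟨ι ⊕ ι', inferInstance, Sum.elim z z', ?_, ?_, ?_⟩
    · rw [Fintype.card_sum, hc, hc', Finsupp.sum_add_index'] <;> simp [add_mul]
    · rintro (i | i)
      · refine localModule_mono S ?_ (hz i)
        intro P
        simp
      · convert! hz' i using 2
        ext P
        simp [add_assoc]
    · refine Submodule.linearIndependent_mkQ_sumElim (localModule_mono S ?_) hz hli hli'
      intro P
      simp
  | single P e =>
    by_cases hP : P ∈ S
    swap
    · exact ⟨Empty, inferInstance, Empty.elim, by simp [hdS P hP], by simp,
        linearIndependent_empty_type⟩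
    obtain ⟨a, ha⟩ := hd P hP
    induction e with
    | zero =>
      exact ⟨Empty, inferInstance, Empty.elim, by simp, by simp, linearIndependent_empty_type⟩
    | succ e ih =>
      obtain ⟨ι, _, z, hc, hz, hli⟩ := ih
      set m' : Place K F → ℤ := m + fun Q => (Finsupp.single P e Q : ℤ) with hm'
      set m'' : Place K F → ℤ := m + fun Q => (Finsupp.single P (e + 1) Q : ℤ) with hm''
      have hle : m' ≤ m'' := by
        intro Q
        simp only [hm', hm'', Pi.add_apply, Finsupp.single_apply]
        split_ifs <;> simp
      have hP1 : m' P = m'' P - 1 := by simp [hm', hm'']; ring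
      choose w hw hw' hwa using fun i => exists_leadingCoeff_eq hP m'' (a i)
      refine ⟨ι ⊕ Fin (d P), inferInstance, Sum.elim z w, ?_, ?_, ?_⟩
      · rw [Fintype.card_sum, hc, Finsupp.sum_single_index (by simp),
          Finsupp.sum_single_index (by simp)]
        simp [add_mul]
      · rintro (i | i)
        · exact localModule_mono S hle (hz i)
        · exact hw i
      · refine Submodule.linearIndependent_mkQ_sumElim (localModule_mono S ?_) hz hli ?_
        · intro P; simp [hm']
        · rw [Submodule.linearIndependent_mkQ_iff]
          rw [Fintype.linearIndependent_iff] at ha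
          intro c hcsum
          refine ha c ?_
          simp only [← hwa, ← map_smul, ← map_sum]
          rw [leadingCoeff_eq_zero_iff, ← hP1]
          simpa [mem_filtration] using mem_localModule.1 hcsum P hP

/-- Multiplication by `y` maps the functions regular on `S` into those of order at least `e P` at
each `P` in `S`, and the quotient of these spaces has dimension at least the left-hand side. -/
theorem sum_mul_le_finrank {y : F} (hy : y ≠ 0) [FiniteDimensional K⟮y⟯ F]
    (S : Finset (Place K F)) (e d : Place K F → ℕ)
    (he : ∀ P ∈ S, P.valuation y ≤ WithZero.exp (-(e P : ℤ)))
    (hd : ∀ P ∈ S, ∃ a : Fin (d P) → IsLocalRing.ResidueField P.ring, LinearIndependent K a) :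
    ∑ P ∈ S, e P * d P ≤ Module.finrank K⟮y⟯ F := by
  classical
  set E : Place K F →₀ ℕ := Finsupp.onFinset S (fun P => if P ∈ S then e P else 0)
    (fun P h => by by_contra hP; simp [hP] at h) with hE
  obtain ⟨ι, _, z, hc, hz, hli⟩ := exists_linearIndependent_mkQ S
    (fun P => if P ∈ S then d P else 0) (fun P hP => by simp [hP])
    (fun P hP => by rw [if_pos hP]; exact hd P hP) E (fun P => -(E P : ℤ))
  have hsum : ∑ P ∈ S, e P * d P = Fintype.card ι := by
    rw [hc, hE, Finsupp.onFinset_sum _ (by simp)]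
    exact Finset.sum_congr rfl fun P hP => by simp [hP]
  rw [hsum]
  refine card_le_finrank_of_linearIndependent_mkQ hy (localModule_mono S ?_) ?_ hz hli
  · intro P; simp
  · intro f hf
    refine mem_localModule.2 fun P hP => ?_
    have h1 := mem_localModule.1 hf P hP
    have h2 := he P hP
    rw [map_mul]
    refine (mul_le_mul' h2 h1).trans_eq ?_
    rw [← WithZero.exp_add]
    simp [hE, hP]

end Place

end

noncomputable section

/-! ### Existence of places and finiteness of residue fields -/

open IntermediateField

namespace Place

variable {K F : Type*} [Field K] [Field F] [Algebra K F]

/-- For `z ≠ 0` in an ideal `I`, either `z` is algebraic, hence a unit, or `R / zR` has dimension at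
most `[F : K(z)]` over `K`. In both cases `I` is finitely generated. This is what makes an abstract
valuation ring discrete. -/
theorem isNoetherianRing_of_finiteDimensional_adjoin {R : Type*} [CommRing R] [Algebra K R]
    [Algebra R F] [IsScalarTower K R F] (hinj : Function.Injective (algebraMap R F))
    (hfin : ∀ y : F, Transcendental K y → FiniteDimensional K⟮y⟯ F) :
    IsNoetherianRing R := by
  have : IsDomain R := hinj.isDomain (algebraMap R F)
  rw [isNoetherianRing_iff_ideal_fg]
  intro I
  by_cases hI : I = ⊥
  · rw [hI]; exact Submodule.fg_bot
  obtain ⟨z, hzI, hz0⟩ := Submodule.exists_mem_ne_zero_of_ne_bot hI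
  have hz0' : algebraMap R F z ≠ 0 := by rwa [Ne, map_eq_zero_iff _ hinj]
  by_cases hz : IsAlgebraic K z
  · have : I = ⊤ := I.eq_top_of_isUnit_mem hzI
      (hz.isIntegral.isUnit hz0)
    rw [this]
    exact ⟨{1}, by simp⟩
  have := hfin _ fun h => hz ((isAlgebraic_algebraMap_iff hinj).1 h)
  have hrank : Module.rank K (R ⧸ Ideal.span {z}) ≤ Module.finrank K⟮algebraMap R F z⟯ F := by
    refine rank_le fun s hs => ?_
    choose w hw using fun i : s => Ideal.Quotient.mk_surjective (i : R ⧸ Ideal.span {z})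
    rw [← Fintype.card_coe]
    refine card_le_finrank_of_linearIndependent_mkQ (z := fun i : s => algebraMap R F (w i)) hz0'
      (M := (IsScalarTower.toAlgHom K R F).toLinearMap.range)
      (U := (IsScalarTower.toAlgHom K R F).toLinearMap.range.map
        (LinearMap.mulLeft K (algebraMap R F z))) ?_ ?_
      (fun i => ⟨w i, rfl⟩) ?_
    · rintro _ ⟨_, ⟨f, rfl⟩, rfl⟩
      exact ⟨z * f, by simp⟩
    · intro f hf
      exact ⟨f, hf, rfl⟩
    · rw [Submodule.linearIndependent_mkQ_iff]
      rw [Fintype.linearIndependent_iff] at hs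
      rintro c ⟨_, ⟨f, rfl⟩, hfc⟩
      refine hs c ?_
      simp only [← hw]
      have : ∑ i, c i • w i = z * f := by
        refine hinj ?_
        simpa [Algebra.smul_def, ← IsScalarTower.algebraMap_apply] using hfc.symm
      have h2 : Ideal.Quotient.mkₐ K (Ideal.span {z}) (∑ i, c i • w i) = 0 := by
        rw [this, Ideal.Quotient.mkₐ_eq_mk, Ideal.Quotient.eq_zero_iff_mem]
        exact Ideal.mul_mem_right _ _ (Ideal.subset_span rfl)
      simpa using h2
  have hf : Module.Finite K (R ⧸ Ideal.span {z}) :=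
    Module.rank_lt_aleph0_iff.1 (hrank.trans_lt Cardinal.natCast_lt_aleph0)
  have hN : IsNoetherian R (R ⧸ Ideal.span {z}) := isNoetherian_of_tower K inferInstance
  refine Submodule.fg_of_fg_map_of_fg_inf_ker (Submodule.mkQ (Ideal.span {z})) ?_ ?_
  · exact hN.noetherian _
  · rw [Submodule.ker_mkQ, inf_eq_right.2 ((Ideal.span_singleton_le_iff_mem I).2 hzI)]
    exact ⟨{z}, by simp⟩

/-- As `x` is transcendental, `x⁻¹` is not a unit of `K[x⁻¹]`, so some valuation ring of `F`
containing `K[x⁻¹]` has `x⁻¹` as a non-unit. It is Noetherian and not a field, hence the ring of a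
place. -/
theorem exists_one_lt_valuation_of_finiteDimensional_adjoin
    (hfin : ∀ y : F, Transcendental K y → FiniteDimensional K⟮y⟯ F) {x : F}
    (hx : Transcendental K x) : ∃ P : Place K F, 1 < P.valuation x := by
  have hx0 : x ≠ 0 := by
    rintro rfl
    exact hx isAlgebraic_zero
  have hxA : x ∉ Algebra.adjoin K {x⁻¹} := fun h => by
    obtain ⟨p, hp⟩ := (Algebra.adjoin_singleton_eq_range_aeval K x⁻¹).le h
    have hy : Transcendental K x⁻¹ := fun h => hx (by simpa using h.inv)
    have h1 : p * Polynomial.X - 1 = 0 := by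
      refine (transcendental_iff.1 hy) _ ?_
      have hp' : Polynomial.aeval x⁻¹ p = x := hp
      simp [hp', hx0]
    have h2 := congrArg (Polynomial.eval 0) h1
    simp at h2
  obtain ⟨V, hAV, hV⟩ := Ideal.image_subset_nonunits_valuationSubring
    (A := (Algebra.adjoin K {x⁻¹}).toSubring)
    (Ideal.span {⟨x⁻¹, Algebra.subset_adjoin rfl⟩}) (fun h => by
      obtain ⟨a, ha⟩ := Ideal.mem_span_singleton'.1 ((Ideal.eq_top_iff_one _).1 h)
      have ha' : (a : F) * x⁻¹ = 1 := congrArg Subtype.val ha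
      rw [← div_eq_mul_inv, div_eq_one_iff_eq hx0] at ha'
      have hxa : x = a := ha'.symm
      have ham : (a : F) ∈ Algebra.adjoin K {x⁻¹} := a.2
      rw [← hxa] at ham
      exact hxA ham)
  have hyV : x⁻¹ ∈ V.nonunits := hV ⟨_, Ideal.subset_span rfl, rfl⟩
  have hxV : x ∉ V := by
    simpa [hx0] using V.inv_mem_nonunits_iff.1 hyV
  let O : Subalgebra K F := { V.toSubring with
    algebraMap_mem' := fun c => hAV (Subalgebra.algebraMap_mem _ c) }
  have hOfrac : IsFractionRing O F := inferInstanceAs (IsFractionRing V F)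
  have hOval : ValuationRing O := inferInstanceAs (ValuationRing V)
  have := isNoetherianRing_of_finiteDimensional_adjoin (R := O) (F := F) Subtype.val_injective hfin
  have hfield : ¬ IsField O := fun h => by
    have hyO : x⁻¹ ∈ O := V.nonunits_subset hyV
    obtain ⟨b, hb⟩ := h.mul_inv_cancel (a := ⟨x⁻¹, hyO⟩) (fun h => by
      simpa [hx0] using congrArg Subtype.val h)
    have hb' : x⁻¹ * (b : F) = 1 := congrArg Subtype.val hb
    have : (b : F) = x := by
      rw [inv_mul_eq_one₀ hx0] at hb'
      exact hb'.symm
    exact hxV (this ▸ b.2)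
  have hOdvr : IsDiscreteValuationRing O :=
    ((IsDiscreteValuationRing.TFAE O hfield).out 0 1).2 hOval
  refine ⟨⟨O, hOfrac, hOdvr⟩, ?_⟩
  rw [← not_le, ← mem_ring_iff]
  exact hxV

end Place

/-! ### Degrees of divisors -/

namespace FunctionFieldDivisor

variable {K F : Type*} [Field K] [Field F] [Algebra K F]

theorem mem_riemannRochSpace {D : FunctionFieldDivisor K F} {f : F} :
    f ∈ D.riemannRochSpace ↔ ∀ P : Place K F, f ∈ P.filtration (D P) := Iff.rfl

theorem degree_add (D E : FunctionFieldDivisor K F) : (D + E).degree = D.degree + E.degree :=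
  Finsupp.sum_add_index' (by simp) (by simp [add_mul])

theorem degree_neg (D : FunctionFieldDivisor K F) : (-D).degree = -D.degree := by
  have := degree_add D (-D)
  rw [add_neg_cancel] at this
  simp only [degree, Finsupp.sum_zero_index] at this ⊢
  linarith

theorem degree_sub (D E : FunctionFieldDivisor K F) : (D - E).degree = D.degree - E.degree := by
  rw [sub_eq_add_neg, degree_add, degree_neg, sub_eq_add_neg]

theorem degree_single (P : Place K F) (m : ℤ) :
    degree (Finsupp.single P m) = m * P.degree := Finsupp.sum_single_index (by simp)

theorem degree_nonneg {D : FunctionFieldDivisor K F} (hD : 0 ≤ D) : 0 ≤ D.degree :=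
  Finset.sum_nonneg fun P _ => mul_nonneg (hD P) (by positivity)

theorem degree_smul (m : ℤ) (D : FunctionFieldDivisor K F) : (m • D).degree = m * D.degree := by
  induction D using Finsupp.induction_linear with
  | zero => simp [degree]
  | add D E hD hE => rw [smul_add, degree_add, degree_add, hD, hE]; ring
  | single P a => rw [Finsupp.smul_single, degree_single, degree_single, smul_eq_mul]; ring

end FunctionFieldDivisor

theorem IntermediateField.adjoin_simple_inv_eq {K F : Type*} [Field K] [Field F] [Algebra K F]
    (x : F) : K⟮x⁻¹⟯ = K⟮x⟯ := by
  refine le_antisymm ?_ ?_ <;> rw [adjoin_simple_le_iff]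
  · exact inv_mem (mem_adjoin_simple_self K x)
  · simpa using inv_mem (mem_adjoin_simple_self K x⁻¹)

/-! ### Zeros and poles in function fields -/

section FunctionField

variable {K F : Type*} [Field K] [Field F] [Algebra K F]
  [Algebra (RatFunc K) F] [IsScalarTower K (RatFunc K) F] [FunctionField K F]

namespace Place

theorem exists_one_lt_valuation {x : F} (hx : Transcendental K x) :
    ∃ P : Place K F, 1 < P.valuation x :=
  exists_one_lt_valuation_of_finiteDimensional_adjoin
    (fun _ => FunctionField.finiteDimensional_of_adjoin_transcendental) hx

/-- A uniformizer vanishes at `P`, so it is transcendental, and the inequality with the single place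
`P` bounds every finite independent family in the residue field. -/
instance finite_residueField (P : Place K F) :
    Module.Finite K (IsLocalRing.ResidueField P.ring) := by
  have hlt : P.valuation P.uniformizer < 1 := by
    rw [valuation_uniformizer, ← WithZero.exp_zero, WithZero.exp_lt_exp]
    norm_num
  have := FunctionField.finiteDimensional_of_adjoin_transcendental
    (P.transcendental_of_valuation_lt_one P.uniformizer_ne_zero hlt)
  refine Module.rank_lt_aleph0_iff.1 (lt_of_le_of_lt (rank_le
    (n := Module.finrank K⟮P.uniformizer⟯ F) fun s hs => ?_) Cardinal.natCast_lt_aleph0)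
  have := sum_mul_le_finrank P.uniformizer_ne_zero {P} (fun _ => 1) (fun _ => s.card)
    (by simp) (fun Q hQ => by
      rw [Finset.mem_singleton.1 hQ]
      exact ⟨fun i => (s.equivFin.symm i : IsLocalRing.ResidueField P.ring),
        hs.comp _ s.equivFin.symm.injective⟩)
  simpa using this

theorem degree_pos (P : Place K F) : 0 < P.degree := Module.finrank_pos

/-- The fundamental inequality `∑ e f ≤ [F : K(y)]`. -/
theorem sum_mul_degree_le_finrank {y : F} (hy : Transcendental K y) (S : Finset (Place K F))
    (e : Place K F → ℕ) (he : ∀ P ∈ S, P.valuation y ≤ WithZero.exp (-(e P : ℤ))) :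
    ∑ P ∈ S, e P * P.degree ≤ Module.finrank K⟮y⟯ F := by
  have := FunctionField.finiteDimensional_of_adjoin_transcendental hy
  refine sum_mul_le_finrank ?_ S e _ he fun P _ =>
    ⟨Module.finBasis K _, (Module.finBasis K _).linearIndependent⟩
  rintro rfl
  exact hy isAlgebraic_zero

/-- A function with a zero is transcendental, and each zero contributes at least one to a sum
bounded by `[F : K(f)]`. -/
theorem finite_setOf_valuation_lt_one {f : F} (hf : f ≠ 0) :
    {P : Place K F | P.valuation f < 1}.Finite := by
  rcases Set.eq_empty_or_nonempty {P : Place K F | P.valuation f < 1} with h | ⟨P, hP⟩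
  · rw [h]; exact Set.finite_empty
  have htr := P.transcendental_of_valuation_lt_one hf hP
  by_contra hinf
  obtain ⟨S, hS, hcard⟩ := Set.Infinite.exists_subset_card_eq hinf (Module.finrank K⟮f⟯ F + 1)
  have h1 := sum_mul_degree_le_finrank htr S (fun _ => 1) (fun Q hQ => by
    have hQ1 : Q.valuation f < 1 := hS hQ
    obtain ⟨x, hx⟩ := Q.exists_valuation_eq_exp hf
    rw [hx, ← WithZero.exp_zero, WithZero.exp_lt_exp] at hQ1
    rw [hx, WithZero.exp_le_exp]
    push_cast
    omega)
  have h2 : S.card ≤ ∑ P ∈ S, 1 * P.degree := by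
    rw [Finset.card_eq_sum_ones]
    exact Finset.sum_le_sum fun Q _ => by simpa using Nat.succ_le_of_lt Q.degree_pos
  omega

end Place

/-! ### Principal divisors and divisors of poles -/

namespace FunctionFieldDivisor

theorem finite_support_log (f : F) :
    (Function.support fun P : Place K F => -WithZero.log (P.valuation f)).Finite := by
  by_cases hf : f = 0
  · simp [hf]
  refine ((Place.finite_setOf_valuation_lt_one hf).union
    (Place.finite_setOf_valuation_lt_one (inv_ne_zero hf))).subset fun P hP => ?_
  obtain ⟨x, hx⟩ := P.exists_valuation_eq_exp hf
  simp only [Function.mem_support, hx, WithZero.log_exp] at hP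
  simp only [Set.mem_union, Set.mem_ofPred_eq, map_inv₀, hx, ← WithZero.exp_neg]
  rw [← WithZero.exp_zero, WithZero.exp_lt_exp, WithZero.exp_lt_exp]
  omega

/-- The principal divisor of a function `f`. -/
def principal (K : Type*) {F : Type*} [Field K] [Field F] [Algebra K F]
    [Algebra (RatFunc K) F] [IsScalarTower K (RatFunc K) F] [FunctionField K F] (f : F) :
    FunctionFieldDivisor K F :=
  Finsupp.ofSupportFinite (fun P => -WithZero.log (P.valuation f)) (finite_support_log f)

theorem principal_apply (f : F) (P : Place K F) :
    principal K f P = -WithZero.log (P.valuation f) := rfl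

theorem valuation_eq_exp_neg_principal {f : F} (hf : f ≠ 0) (P : Place K F) :
    P.valuation f = WithZero.exp (-principal K f P) := by
  rw [principal_apply, neg_neg, WithZero.exp_log ((P.valuation.ne_zero_iff).2 hf)]

theorem principal_inv (f : F) : principal K f⁻¹ = -principal K f := by
  ext P
  simp [principal_apply, WithZero.log_inv]

theorem mem_riemannRochSpace_iff {D : FunctionFieldDivisor K F} {f : F} (hf : f ≠ 0) :
    f ∈ D.riemannRochSpace ↔ 0 ≤ D + principal K f := by
  rw [mem_riemannRochSpace, Finsupp.le_def]
  refine forall_congr' fun P => ?_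
  rw [Place.mem_filtration, valuation_eq_exp_neg_principal hf, WithZero.exp_le_exp,
    Finsupp.add_apply, Finsupp.zero_apply]
  omega

/-- The divisor of poles of a function. -/
def poles (K : Type*) {F : Type*} [Field K] [Field F] [Algebra K F]
    [Algebra (RatFunc K) F] [IsScalarTower K (RatFunc K) F] [FunctionField K F] (f : F) :
    FunctionFieldDivisor K F :=
  (-principal K f) ⊔ 0

theorem poles_nonneg (f : F) : 0 ≤ poles K f := le_sup_right

theorem principal_eq (f : F) : principal K f = poles K f⁻¹ - poles K f := by
  ext P
  simp only [poles, principal_inv, Finsupp.sub_apply, Finsupp.sup_apply, Finsupp.neg_apply,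
    Finsupp.zero_apply, neg_neg]
  rcases le_total 0 (principal K f P) with h | h <;> simp [h]

/-- The poles of `x⁻¹` are the zeros of `x`, so this is the fundamental inequality with the zero
orders of `x`. -/
theorem degree_poles_inv_le {x : F} (hx : Transcendental K x) :
    (poles K x⁻¹).degree ≤ Module.finrank K⟮x⟯ F := by
  have hx0 : x ≠ 0 := by rintro rfl; exact hx isAlgebraic_zero
  have := Place.sum_mul_degree_le_finrank hx (poles K x⁻¹).support
    (fun P => (principal K x P).toNat) (fun P hP => by
      rw [valuation_eq_exp_neg_principal hx0, WithZero.exp_le_exp]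
      simp only [poles, principal_inv, neg_neg, Finsupp.mem_support_iff, Finsupp.sup_apply,
        Finsupp.zero_apply] at hP
      omega)
  refine le_trans (le_of_eq ?_) (Nat.cast_le.2 this)
  rw [degree, Finsupp.sum]
  push_cast
  refine Finset.sum_congr rfl fun P _ => ?_
  rw [poles, principal_inv, neg_neg, Finsupp.sup_apply, Finsupp.zero_apply,
    Int.toNat_eq_max]

theorem degree_poles_le {x : F} (hx : Transcendental K x) :
    (poles K x).degree ≤ Module.finrank K⟮x⟯ F := by
  have := degree_poles_inv_le (K := K) (x := x⁻¹) fun h => hx (by simpa using h.inv)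
  rwa [inv_inv, adjoin_simple_inv_eq] at this

end FunctionFieldDivisor

end FunctionField

end

noncomputable section

/-! ### Riemann's theorem -/

open IntermediateField

theorem Submodule.finite_and_finrank_le_of_ker_le {K V W : Type*} [Field K] [AddCommGroup V]
    [Module K V] [AddCommGroup W] [Module K W] [Module.Finite K W] {A B : Submodule K V}
    [Module.Finite K A] (φ : B →ₗ[K] W) (h : ∀ b, φ b = 0 → (b : V) ∈ A) :
    Module.Finite K B ∧ Module.finrank K B ≤ Module.finrank K A + Module.finrank K W := by
  let ψ : φ.ker →ₗ[K] A := (B.subtype ∘ₗ φ.ker.subtype).codRestrict A fun b => h b b.2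
  have hψ : Function.Injective ψ := fun b c hbc => by
    exact Subtype.ext (Subtype.ext (congrArg (fun a : A => (a : V)) hbc))
  have : Module.Finite K φ.ker := Module.Finite.of_injective ψ hψ
  have : Module.Finite K (B ⧸ φ.ker) := Module.Finite.equiv φ.quotKerEquivRange.symm
  have hB : Module.Finite K B := Module.Finite.of_submodule_quotient φ.ker
  refine ⟨hB, ?_⟩
  rw [← φ.finrank_range_add_finrank_ker, add_comm]
  exact add_le_add (LinearMap.finrank_le_finrank_of_injective hψ) (Submodule.finrank_le _)

theorem Transcendental.linearIndependent_pow {K F : Type*} [Field K] [CommRing F] [Algebra K F]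
    {x : F} (hx : Transcendental K x) : LinearIndependent K fun i : ℕ => x ^ i := by
  have h := (Polynomial.basisMonomials K).linearIndependent.map' (Polynomial.aeval x).toLinearMap
    (LinearMap.ker_eq_bot.2 (transcendental_iff_injective.1 hx))
  convert! h using 2 with i
  simp [Polynomial.aeval_monomial]

namespace FunctionFieldDivisor

section

variable {K F : Type*} [Field K] [Field F] [Algebra K F]

theorem riemannRochSpace_mono {D E : FunctionFieldDivisor K F} (h : D ≤ E) :
    D.riemannRochSpace ≤ E.riemannRochSpace := fun _ hf P =>
  P.filtration_mono (h P) (hf P)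

theorem riemannRochSpace_le_filtration (D : FunctionFieldDivisor K F) (P : Place K F) :
    D.riemannRochSpace ≤ P.filtration (D P) := fun _ hf => hf P

/-- The leading coefficient at `P` of the functions in `ℒ(D)`. -/
def leadingCoeff (D : FunctionFieldDivisor K F) (P : Place K F) :
    D.riemannRochSpace →ₗ[K] IsLocalRing.ResidueField P.ring :=
  P.leadingCoeff (D P) ∘ₗ Submodule.inclusion (D.riemannRochSpace_le_filtration P)

theorem leadingCoeff_eq_zero_iff {D : FunctionFieldDivisor K F} {P : Place K F}
    (f : D.riemannRochSpace) :
    D.leadingCoeff P f = 0 ↔ (f : F) ∈ (D - Finsupp.single P 1).riemannRochSpace := by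
  classical
  rw [leadingCoeff, LinearMap.comp_apply, Place.leadingCoeff_eq_zero_iff, mem_riemannRochSpace,
    Submodule.coe_inclusion]
  refine ⟨fun h Q => ?_, fun h => by simpa using h P⟩
  by_cases hQ : P = Q
  · subst hQ; simpa using h
  · simpa [Finsupp.single_apply, hQ] using mem_riemannRochSpace.1 f.2 Q

end

variable {K F : Type*} [Field K] [Field F] [Algebra K F]
  [Algebra (RatFunc K) F] [IsScalarTower K (RatFunc K) F] [FunctionField K F]

/-- Adding one place `P` enlarges the space by at most the residue field of `P`, since the kernel of
the leading coefficient is the old space. Finiteness is carried along because `finrank` is `0` on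
infinite-dimensional spaces. -/
theorem finite_and_dim_le_add_natCast (E : Place K F →₀ ℕ) (D : FunctionFieldDivisor K F)
    (hD : Module.Finite K D.riemannRochSpace) :
    Module.Finite K (D + E.mapRange (Nat.cast : ℕ → ℤ) Nat.cast_zero).riemannRochSpace ∧
      (dim (D + E.mapRange (Nat.cast : ℕ → ℤ) Nat.cast_zero) : ℤ) ≤
        D.dim + degree (E.mapRange (Nat.cast : ℕ → ℤ) Nat.cast_zero) := by
  induction E using Finsupp.induction_linear generalizing D with
  | zero =>
    rw [Finsupp.mapRange_zero, add_zero]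
    exact ⟨hD, by simp [degree]⟩
  | add E E' h h' =>
    rw [Finsupp.mapRange_add (by simp), ← add_assoc, degree_add]
    obtain ⟨h1, h2⟩ := h D hD
    obtain ⟨h3, h4⟩ := h' _ h1
    exact ⟨h3, by linarith⟩
  | single P e =>
    induction e with
    | zero =>
      rw [Finsupp.single_zero, Finsupp.mapRange_zero, add_zero]
      exact ⟨hD, by simp [degree]⟩
    | succ e ih =>
      obtain ⟨h1, h2⟩ := ih
      have heq : D + Finsupp.single P ((e + 1 : ℕ) : ℤ) - Finsupp.single P 1 =
          D + Finsupp.single P (e : ℤ) := by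
        rw [Nat.cast_add, Nat.cast_one, Finsupp.single_add]
        abel
      rw [Finsupp.mapRange_single] at h1 h2 ⊢
      have := Submodule.finite_and_finrank_le_of_ker_le
        (A := (D + Finsupp.single P (e : ℤ)).riemannRochSpace)
        ((D + Finsupp.single P ((e + 1 : ℕ) : ℤ)).leadingCoeff P) fun f hf => by
          rw [leadingCoeff_eq_zero_iff, heq] at hf
          exact hf
      refine ⟨this.1, (Nat.cast_le.2 this.2).trans ?_⟩
      rw [degree_single] at h2 ⊢
      push_cast
      change (dim (D + Finsupp.single P (e : ℤ)) : ℤ) + P.degree ≤ _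
      linarith

theorem finite_and_dim_le_of_le {D D' : FunctionFieldDivisor K F} (h : D ≤ D')
    (hD : Module.Finite K D.riemannRochSpace) :
    Module.Finite K D'.riemannRochSpace ∧ (D'.dim : ℤ) ≤ D.dim + (D'.degree - D.degree) := by
  have := finite_and_dim_le_add_natCast ((D' - D).mapRange Int.toNat rfl) D hD
  have heq : ((D' - D).mapRange Int.toNat rfl).mapRange (Nat.cast : ℕ → ℤ) Nat.cast_zero =
      D' - D := by
    ext P
    simpa using h P
  rwa [heq, add_sub_cancel, degree_sub] at this

theorem exists_transcendental (K F : Type*) [Field K] [Field F] [Algebra K F]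
    [Algebra (RatFunc K) F] [IsScalarTower K (RatFunc K) F] : ∃ x : F, Transcendental K x :=
  ⟨algebraMap (RatFunc K) F RatFunc.X,
    (transcendental_algebraMap_iff (algebraMap (RatFunc K) F).injective).2 RatFunc.transcendental_X⟩

/-- A nonzero function with a zero is transcendental and hence has a pole; so evaluation at any one
place is injective on functions without poles. -/
theorem finite_riemannRochSpace_zero :
    Module.Finite K (riemannRochSpace (0 : FunctionFieldDivisor K F)) := by
  obtain ⟨x, hx⟩ := exists_transcendental K F
  obtain ⟨P, -⟩ := Place.exists_one_lt_valuation hx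
  refine (Submodule.finite_and_finrank_le_of_ker_le (A := (⊥ : Submodule K F))
    (leadingCoeff 0 P) fun f hf => ?_).1
  by_contra hf0
  rw [Submodule.mem_bot] at hf0
  rw [leadingCoeff_eq_zero_iff] at hf
  have hlt : P.valuation (f : F) < 1 := by
    refine (Place.mem_filtration.1 (hf P)).trans_lt ?_
    rw [← WithZero.exp_zero, WithZero.exp_lt_exp]
    simp
  obtain ⟨Q, hQ⟩ := Place.exists_one_lt_valuation (P.transcendental_of_valuation_lt_one hf0 hlt)
  have := Place.mem_filtration.1 (f.2 Q)
  rw [Finsupp.zero_apply, WithZero.exp_zero] at this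
  exact absurd hQ (not_lt.2 this)

instance finite_riemannRochSpace (D : FunctionFieldDivisor K F) :
    Module.Finite K D.riemannRochSpace := by
  have h := (finite_and_dim_le_of_le (le_sup_right : 0 ≤ D ⊔ 0) finite_riemannRochSpace_zero).1
  exact Module.Finite.of_injective _
    (Submodule.inclusion_injective (riemannRochSpace_mono (le_sup_left : D ≤ D ⊔ 0)))

theorem dim_le_of_le {D D' : FunctionFieldDivisor K F} (h : D ≤ D') :
    (D'.dim : ℤ) ≤ D.dim + (D'.degree - D.degree) :=
  (finite_and_dim_le_of_le h inferInstance).2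

theorem valuation_le_exp_poles (f : F) (P : Place K F) :
    P.valuation f ≤ WithZero.exp (poles K f P) := by
  by_cases hf : f = 0
  · simp [hf]
  rw [valuation_eq_exp_neg_principal hf, WithZero.exp_le_exp]
  exact le_sup_left

/-- For a transcendental function `x` with divisor of poles `B` there is a divisor `C` such that
`ℒ(l B + C)` has dimension at least `(l + 1) [F : K(x)]` for every `l`. -/
theorem exists_finrank_mul_le_dim {x : F} (hx : Transcendental K x) :
    ∃ C : FunctionFieldDivisor K F, 0 ≤ C ∧
      ∀ l : ℕ, (Module.finrank K⟮x⟯ F : ℤ) * (l + 1) ≤ dim ((l : ℤ) • poles K x + C) := by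
  have := FunctionField.finiteDimensional_of_adjoin_transcendental hx
  set n := Module.finrank K⟮x⟯ F
  let u := Module.finBasis K⟮x⟯ F
  -- `C` absorbs the poles of a basis `u` of `F` over `K(x)`; the products `x ^ i * u j` with `i ≤
  -- l` are the independent functions.
  refine ⟨∑ j, poles K (u j), Finset.sum_nonneg fun j _ => poles_nonneg _, fun l => ?_⟩
  set D := (l : ℤ) • poles K x + ∑ j, poles K (u j)
  have hgen : Transcendental K (AdjoinSimple.gen K x) := by
    rw [← transcendental_algebraMap_iff (A := F) (algebraMap K⟮x⟯ F).injective]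
    simpa using hx
  have hli := linearIndependent_smul
    (hgen.linearIndependent_pow.comp (Fin.val : Fin (l + 1) → ℕ) Fin.val_injective)
    u.linearIndependent
  have hmem : ∀ p : Fin (l + 1) × Fin n,
      (AdjoinSimple.gen K x ^ (p.1 : ℕ)) • u p.2 ∈ D.riemannRochSpace := fun p P => by
    have h1 : P.valuation (u p.2) ≤ WithZero.exp ((∑ j, poles K (u j)) P) := by
      refine (valuation_le_exp_poles _ _).trans (WithZero.exp_le_exp.2 ?_)
      exact Finset.single_le_sum (f := fun j => poles K (u j)) (fun j _ => poles_nonneg _)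
        (Finset.mem_univ p.2) P
    have h2 : P.valuation (x ^ (p.1 : ℕ)) ≤ WithZero.exp (l * poles K x P) := by
      rw [map_pow]
      refine (pow_le_pow_left₀ zero_le (valuation_le_exp_poles x P) _).trans ?_
      rw [← WithZero.exp_nsmul, WithZero.exp_le_exp, nsmul_eq_mul]
      refine mul_le_mul_of_nonneg_right ?_ (poles_nonneg x P)
      exact_mod_cast Nat.lt_succ_iff.1 p.1.2
    have h3 : (AdjoinSimple.gen K x ^ (p.1 : ℕ)) • u p.2 = x ^ (p.1 : ℕ) * u p.2 := by
      rw [Algebra.smul_def, map_pow, AdjoinSimple.algebraMap_gen]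
    rw [h3, map_mul]
    refine (mul_le_mul' h2 h1).trans_eq ?_
    rw [← WithZero.exp_add]
    simp [D]
  have hli' : LinearIndependent K fun p : Fin (l + 1) × Fin n =>
      (⟨_, hmem p⟩ : D.riemannRochSpace) :=
    LinearIndependent.of_comp D.riemannRochSpace.subtype hli
  have := hli'.fintype_card_le_finrank
  rw [Fintype.card_prod, Fintype.card_fin, Fintype.card_fin, mul_comm] at this
  exact_mod_cast this

/-- If `deg B < [F : K(x)]`, the lower bound for `ℓ(lB + C)` outgrows the upper bound `ℓ(0) + l deg
B + deg C` as `l` increases. -/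
theorem degree_poles {x : F} (hx : Transcendental K x) :
    (poles K x).degree = Module.finrank K⟮x⟯ F := by
  refine le_antisymm (degree_poles_le hx) ?_
  obtain ⟨C, hC, h⟩ := exists_finrank_mul_le_dim hx
  by_contra! hlt
  have hbound : ∀ l : ℕ, (Module.finrank K⟮x⟯ F : ℤ) * (l + 1) ≤
      dim (0 : FunctionFieldDivisor K F) + l * (poles K x).degree + C.degree := fun l => by
    have h0 : (0 : FunctionFieldDivisor K F) ≤ (l : ℤ) • poles K x + C :=
      add_nonneg (smul_nonneg (Int.natCast_nonneg l) (poles_nonneg x)) hC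
    have h1 := dim_le_of_le h0
    rw [degree_add, degree_smul] at h1
    have h2 : degree (0 : FunctionFieldDivisor K F) = 0 := Finsupp.sum_zero_index
    linarith [h l]
  set a : ℤ := dim (0 : FunctionFieldDivisor K F) + C.degree
  have h1 := hbound a.toNat
  have h2 : a ≤ a.toNat := Int.self_le_toNat a
  have h3 : 0 < (Module.finrank K⟮x⟯ F : ℤ) := by
    have := FunctionField.finiteDimensional_of_adjoin_transcendental hx
    exact_mod_cast Module.finrank_pos
  nlinarith

/-- Zeros and poles of a transcendental `f` both have degree `[F : K(f)]`, because `K(f⁻¹) = K(f)`;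
an algebraic `f` has neither. -/
theorem degree_principal {f : F} (hf : f ≠ 0) : (principal K f).degree = 0 := by
  by_cases halg : IsAlgebraic K f
  · have : principal K f = 0 := by
      ext P
      have h1 := P.valuation_le_one_of_isAlgebraic halg
      have h2 := P.valuation_le_one_of_isAlgebraic halg.inv
      rw [map_inv₀, valuation_eq_exp_neg_principal hf, ← WithZero.exp_neg, ← WithZero.exp_zero,
        WithZero.exp_le_exp] at h2
      rw [valuation_eq_exp_neg_principal hf, ← WithZero.exp_zero, WithZero.exp_le_exp] at h1
      rw [Finsupp.zero_apply]
      omega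
    rw [this]
    exact Finsupp.sum_zero_index
  · have h : Transcendental K f := halg
    have h' : Transcendental K f⁻¹ := fun h' => halg (by simpa using h'.inv)
    rw [principal_eq, degree_sub, degree_poles h, degree_poles h', adjoin_simple_inv_eq, sub_self]

theorem riemannRochSpace_eq_bot_of_degree_neg {D : FunctionFieldDivisor K F} (hD : D.degree < 0) :
    D.riemannRochSpace = ⊥ := by
  rw [Submodule.eq_bot_iff]
  intro f hf
  by_contra hf0
  have := degree_nonneg ((mem_riemannRochSpace_iff hf0).1 hf)
  rw [degree_add, degree_principal hf0] at this
  omega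

theorem dim_add_principal_le (D : FunctionFieldDivisor K F) {z : F} (hz : z ≠ 0) :
    dim (D + principal K z) ≤ D.dim := by
  have hmem : ∀ f ∈ (D + principal K z).riemannRochSpace, z * f ∈ D.riemannRochSpace := by
    intro f hf P
    have := Place.mem_filtration.1 (hf P)
    rw [map_mul, valuation_eq_exp_neg_principal hz]
    refine (mul_le_mul' le_rfl this).trans_eq ?_
    rw [← WithZero.exp_add]
    simp
  exact LinearMap.finrank_le_finrank_of_injective
    (f := (LinearMap.mulLeft K z).restrict hmem)
    fun f g hfg => Subtype.ext (mul_left_cancel₀ hz (congrArg Subtype.val hfg))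

/-- Riemann's theorem. -/
theorem exists_degree_sub_dim_le (K F : Type*) [Field K] [Field F] [Algebra K F]
    [Algebra (RatFunc K) F] [IsScalarTower K (RatFunc K) F] [FunctionField K F] :
    ∃ γ : ℤ, ∀ A : FunctionFieldDivisor K F, A.degree - A.dim ≤ γ := by
  obtain ⟨x, hx⟩ := exists_transcendental K F
  obtain ⟨C, hC, h⟩ := exists_finrank_mul_le_dim hx
  have hB := degree_poles hx
  have hpos : 0 < (poles K x).degree := by
    have := FunctionField.finiteDimensional_of_adjoin_transcendental hx
    rw [hB]
    exact_mod_cast Module.finrank_pos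
  rw [← hB] at h
  set B := poles K x
  have hmul : ∀ l : ℕ, l * B.degree - dim ((l : ℤ) • B) ≤ C.degree := fun l => by
    have h1 := dim_le_of_le (le_add_of_nonneg_right hC : (l : ℤ) • B ≤ (l : ℤ) • B + C)
    rw [degree_add] at h1
    nlinarith [h l]
  refine ⟨C.degree, fun A => ?_⟩
  have hA := dim_le_of_le (le_sup_left : A ≤ A ⊔ 0)
  have hA0 : (0 : FunctionFieldDivisor K F) ≤ A ⊔ 0 := le_sup_right
  set A' := A ⊔ 0
  -- Large enough for `ℓ(lB - A') > 0`. A nonzero `z` in that space gives `A' - (z) ≤ lB`, so the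
  -- bound for the multiples of `B` passes to `A'`, as `deg - ℓ` is monotone.
  set l := (C.degree + A'.degree + 1).toNat
  have hl : C.degree + A'.degree + 1 ≤ l := Int.self_le_toNat _
  have h1 := dim_le_of_le (sub_le_self _ hA0 : (l : ℤ) • B - A' ≤ (l : ℤ) • B)
  rw [degree_sub] at h1
  have h2 : 0 < dim ((l : ℤ) • B - A') := by
    have := hmul l
    have : (0 : ℤ) < dim ((l : ℤ) • B - A') := by nlinarith
    exact_mod_cast this
  have : Nontrivial ((l : ℤ) • B - A').riemannRochSpace := Module.nontrivial_of_finrank_pos h2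
  obtain ⟨⟨z, hz⟩, hz0⟩ := exists_ne (0 : ((l : ℤ) • B - A').riemannRochSpace)
  have hz0' : z ≠ 0 := fun h => hz0 (Subtype.ext h)
  have hle : A' + principal K z⁻¹ ≤ (l : ℤ) • B := by
    have := (mem_riemannRochSpace_iff hz0').1 hz
    rw [principal_inv, ← sub_nonneg]
    convert! this using 1
    abel
  have h3 := dim_le_of_le hle
  rw [degree_add, degree_principal (inv_ne_zero hz0'), degree_smul] at h3
  have h4 := dim_add_principal_le A' (inv_ne_zero hz0')
  have h5 := hmul l
  have h4' : (dim (A' + principal K z⁻¹) : ℤ) ≤ dim A' := by exact_mod_cast h4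
  linarith

/-- Riemann's theorem supplies the upper bound without which `sSup` in `ℤ` says nothing. -/
theorem degree_sub_dim_add_one_le_genus (A : FunctionFieldDivisor K F) :
    A.degree - A.dim + 1 ≤ functionFieldGenus K F := by
  obtain ⟨γ, hγ⟩ := exists_degree_sub_dim_le K F
  refine le_csSup ⟨γ + 1, ?_⟩ ⟨A, rfl⟩
  rintro _ ⟨D, rfl⟩
  linarith [hγ D]

/-- If `R` is a non-special divisor of degree `g - 1`, then taking leading coefficients at `Q`
maps `ℒ(R + Q)` onto the residue field of `Q`. -/
theorem leadingCoeff_surjective_of_isNonspecial {R : FunctionFieldDivisor K F}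
    (hR : R.IsNonspecial) (hdeg : R.degree = functionFieldGenus K F - 1) (Q : Place K F) :
    Function.Surjective ((R + Finsupp.single Q 1).leadingCoeff Q) := by
  have h0 : R.dim = 0 := by
    have : (R.dim : ℤ) = 0 := by
      have h := hR
      rw [IsNonspecial] at h
      linarith
    exact_mod_cast this
  have hbot : R.riemannRochSpace = ⊥ := Submodule.finrank_eq_zero.1 h0
  have hinj : Function.Injective ((R + Finsupp.single Q 1).leadingCoeff Q) := by
    rw [injective_iff_map_eq_zero]
    intro f hf
    rw [leadingCoeff_eq_zero_iff, add_sub_cancel_right, hbot, Submodule.mem_bot] at hf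
    exact Subtype.ext hf
  have h1 := degree_sub_dim_add_one_le_genus (R + Finsupp.single Q 1)
  rw [degree_add, degree_single, hdeg] at h1
  have h2 : Q.degree ≤ dim (R + Finsupp.single Q 1) := by
    have : (Q.degree : ℤ) ≤ dim (R + Finsupp.single Q 1) := by linarith
    exact_mod_cast this
  refine (LinearMap.injective_iff_surjective_of_finrank_eq_finrank ?_).1 hinj
  exact le_antisymm (LinearMap.finrank_le_finrank_of_injective hinj) h2

theorem degree_nonneg_of_leadingCoeff_surjective
    {D : FunctionFieldDivisor K F} {Q : Place K F}
    (hD : Function.Surjective (D.leadingCoeff Q)) : 0 ≤ D.degree := by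
  by_contra! h
  have : Subsingleton D.riemannRochSpace := by
    rw [riemannRochSpace_eq_bot_of_degree_neg h]
    infer_instance
  have := hD.subsingleton
  exact not_subsingleton (IsLocalRing.ResidueField Q.ring) this

end FunctionFieldDivisor

end

noncomputable section

/-! ### Evaluation and interpolation of products -/

theorem nonempty_algEquiv_finiteExt {K L : Type*} [Field K] [Finite K] [Field L] [Algebra K L]
    {n : ℕ} (hn : 1 ≤ n) (hL : Module.finrank K L = n) : Nonempty (L ≃ₐ[K] FiniteExt K n) := by
  have hfin : Module.Finite K L := Module.finite_of_finrank_pos (by omega)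
  have : Finite (FiniteExt K n) := Module.finite_of_finite K
  obtain ⟨φ⟩ := FiniteField.nonempty_algHom_of_finrank_dvd (F := K) (K := L) (L := FiniteExt K n)
    (by rw [hL, finrank_finiteExt K n hn])
  refine ⟨AlgEquiv.ofBijective φ ⟨φ.injective, ?_⟩⟩
  exact (LinearMap.injective_iff_surjective_of_finrank_eq_finrank (f := φ.toLinearMap)
    (by rw [hL, finrank_finiteExt K n hn])).1 φ.injective

/-- Products of `k` elements of `L` can be interpolated from their values in the algebras `M i`:
there are linear maps `ε i : L → M i` such that `∏ j, x j` is a linear function of the products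
`∏ j, ε i (x j)`. -/
def HasInterpolation (K L : Type*) [Field K] [Field L] [Algebra K L] (k : ℕ) {ι : Type*}
    (M : ι → Type*) [∀ i, Field (M i)] [∀ i, Algebra K (M i)] : Prop :=
  ∃ (ε : ∀ i, L →ₗ[K] M i) (Λ : (∀ i, M i) →ₗ[K] L),
    ∀ x : Fin k → L, ∏ j, x j = Λ fun i => ∏ j, ε i (x j)

theorem HasInterpolation.congr {K L L' : Type*} [Field K] [Field L] [Algebra K L] [Field L']
    [Algebra K L'] {k : ℕ} {ι : Type*} {M : ι → Type*} {M' : ι → Type*} [∀ i, Field (M i)]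
    [∀ i, Algebra K (M i)] [∀ i, Field (M' i)] [∀ i, Algebra K (M' i)]
    (h : HasInterpolation K L k M) (e : L ≃ₐ[K] L') (e' : ∀ i, M i ≃ₐ[K] M' i) :
    HasInterpolation K L' k M' := by
  obtain ⟨ε, Λ, h⟩ := h
  refine ⟨fun i => (e' i).toLinearMap ∘ₗ ε i ∘ₗ e.symm.toLinearMap,
    e.toLinearMap ∘ₗ Λ ∘ₗ LinearMap.pi fun i => (e' i).symm.toLinearMap ∘ₗ LinearMap.proj i,
    fun x => e.symm.injective ?_⟩
  rw [map_prod, h]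
  simp only [LinearMap.comp_apply, AlgEquiv.toLinearMap_apply, AlgEquiv.symm_apply_apply]
  congr 1
  funext i
  simp [← map_prod]

namespace FunctionFieldDivisor

variable {K F : Type*} [Field K] [Field F] [Algebra K F]

theorem prod_mem_riemannRochSpace (D : FunctionFieldDivisor K F) {k : ℕ}
    (f : Fin k → D.riemannRochSpace) :
    ∏ j, (f j : F) ∈ ((k : ℤ) • D).riemannRochSpace := fun P =>
  P.prod_mem_filtration fun j => (f j).2 P

theorem leadingCoeff_prod (D : FunctionFieldDivisor K F) {k : ℕ} (f : Fin k → D.riemannRochSpace)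
    (P : Place K F) :
    ((k : ℤ) • D).leadingCoeff P ⟨∏ j, (f j : F), D.prod_mem_riemannRochSpace f⟩ =
      ∏ j, D.leadingCoeff P (f j) :=
  P.leadingCoeff_prod fun j => ⟨f j, (f j).2 P⟩

theorem mem_riemannRochSpace_sub_sum {D : FunctionFieldDivisor K F} {S : Finset (Place K F)}
    {f : D.riemannRochSpace} (hf : ∀ P ∈ S, D.leadingCoeff P f = 0) :
    (f : F) ∈ (D - ∑ P ∈ S, Finsupp.single P 1).riemannRochSpace := by
  classical
  intro P
  change (f : F) ∈ P.filtration ((D - ∑ P ∈ S, Finsupp.single P 1 : FunctionFieldDivisor K F) P)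
  rw [Finsupp.sub_apply, Finsupp.finsetSum_apply]
  simp only [Finsupp.single_apply, Finset.sum_ite_eq']
  split_ifs with hP
  · have := mem_riemannRochSpace.1 ((leadingCoeff_eq_zero_iff f).1 (hf P hP)) P
    simpa using this
  · simpa using mem_riemannRochSpace.1 f.2 P

theorem degree_sum (S : Finset (Place K F)) :
    degree (∑ P ∈ S, Finsupp.single P 1) = ∑ P ∈ S, (P.degree : ℤ) := by
  classical
  induction S using Finset.induction_on with
  | empty => exact Finsupp.sum_zero_index
  | insert P S hP ih =>
    rw [Finset.sum_insert hP, Finset.sum_insert hP, degree_add, degree_single, ih, one_mul]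

variable [Algebra (RatFunc K) F] [IsScalarTower K (RatFunc K) F] [FunctionField K F]

/-- Lift the arguments by a linear section `s` and multiply in `F`. Evaluation `E` on `ℒ(kD)` is
injective, its kernel lying in a space of negative degree, so a linear left inverse recovers the
product function, which is then read off at `Q`. -/
theorem hasInterpolation {D : FunctionFieldDivisor K F} {Q : Place K F}
    (hD : Function.Surjective (D.leadingCoeff Q)) (k : ℕ) {S : Finset (Place K F)}
    (hS : k * D.degree < ∑ P ∈ S, (P.degree : ℤ)) :
    HasInterpolation K (IsLocalRing.ResidueField Q.ring) k
      fun P : S => IsLocalRing.ResidueField P.1.ring := by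
  obtain ⟨s, hs⟩ := (D.leadingCoeff Q).exists_rightInverse_of_surjective
    (LinearMap.range_eq_top.2 hD)
  let E : ((k : ℤ) • D).riemannRochSpace →ₗ[K]
      ∀ P : S, IsLocalRing.ResidueField P.1.ring :=
    LinearMap.pi fun P => ((k : ℤ) • D).leadingCoeff P.1
  have hE : E.ker = ⊥ := by
    rw [LinearMap.ker_eq_bot']
    intro f hf
    have hmem := mem_riemannRochSpace_sub_sum (S := S) (f := f) fun P hP => congrFun hf ⟨P, hP⟩
    rw [riemannRochSpace_eq_bot_of_degree_neg, Submodule.mem_bot] at hmem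
    · exact Subtype.ext hmem
    · rw [degree_sub, degree_smul, degree_sum]
      linarith
  obtain ⟨Λ, hΛ⟩ := E.exists_leftInverse_of_injective hE
  refine ⟨fun P => D.leadingCoeff P.1 ∘ₗ s, ((k : ℤ) • D).leadingCoeff Q ∘ₗ Λ, fun x => ?_⟩
  have h1 : (fun P : S => ∏ j, (D.leadingCoeff P.1 ∘ₗ s) (x j)) =
      E ⟨∏ j, (s (x j) : F), D.prod_mem_riemannRochSpace fun j => s (x j)⟩ := by
    funext P
    exact (D.leadingCoeff_prod (fun j => s (x j)) P.1).symm
  rw [h1, LinearMap.comp_apply, ← LinearMap.comp_apply Λ, hΛ, LinearMap.id_apply,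
    leadingCoeff_prod]
  exact Finset.prod_congr rfl fun j _ => (LinearMap.congr_fun hs (x j)).symm

end FunctionFieldDivisor

/-! ### Multilinear algorithms by interpolation -/

section

variable {K L : Type*} [Field K] [Field L] [Algebra K L]

theorem HasMultilinearAlgorithm.of_fintype {k : ℕ} {κ : Type*} [Fintype κ]
    (a : κ → Fin k → Module.Dual K L) (c : κ → L)
    (h : ∀ x : Fin k → L, ∏ j, x j = ∑ i, (∏ j, a i j (x j)) • c i) :
    HasMultilinearAlgorithm K L k (Fintype.card κ) := by
  let e := (Fintype.equivFin κ).symm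
  refine ⟨fun i => a (e i), fun i => c (e i), fun x => ?_⟩
  rw [h x]
  exact (e.sum_comp fun i => (∏ j, a i j (x j)) • c i).symm

theorem HasInterpolation.hasMultilinearAlgorithm {k : ℕ} {ι : Type*} [Fintype ι] {M : ι → Type*}
    [∀ i, Field (M i)] [∀ i, Algebra K (M i)] (h : HasInterpolation K L k M) {s : ι → ℕ}
    (hs : ∀ i, HasMultilinearAlgorithm K (M i) k (s i)) :
    HasMultilinearAlgorithm K L k (∑ i, s i) := by
  classical
  obtain ⟨ε, Λ, h⟩ := h
  choose a c hac using hs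
  have hcard : Fintype.card (Σ i, Fin (s i)) = ∑ i, s i := by simp
  rw [← hcard]
  refine .of_fintype (fun p j => a p.1 p.2 j ∘ₗ ε p.1) (fun p => Λ (Pi.single p.1 (c p.1 p.2)))
    fun x => ?_
  rw [h x, Fintype.sum_sigma]
  have : (fun i => ∏ j, ε i (x j)) =
      ∑ i, ∑ t, (∏ j, a i t j (ε i (x j))) • Pi.single (M := M) i (c i t) := by
    funext i
    rw [hac, Finset.sum_apply, Finset.sum_eq_single i]
    · simp
    · intro i' _ hi'
      simp [Finset.sum_apply, Pi.single_eq_of_ne' hi']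
    · simp
  rw [this]
  simp

/-! ### Straight-line computations -/

/-- `W` is the space of the quantities available for free after some straight-line computation
with `s` multiplications. -/
def IsComputableSpace (K L : Type*) [Field K] [Field L] [Algebra K L] (k s : ℕ)
    (W : Submodule K ((Fin k → L) → K)) : Prop :=
  ∃ w : Fin s → (Fin k → L) → K,
    (∀ t : Fin s,
      ∃ u ∈ Submodule.span K (inputForms K L k ∪ w '' {t' | t' < t}),
      ∃ v ∈ Submodule.span K (inputForms K L k ∪ w '' {t' | t' < t}), w t = u * v) ∧
    W = Submodule.span K (inputForms K L k ∪ Set.range w)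

variable {k : ℕ}

theorem isComputableSpace_zero :
    IsComputableSpace K L k 0 (Submodule.span K (inputForms K L k)) :=
  ⟨Fin.elim0, fun t => t.elim0, by simp⟩

theorem IsComputableSpace.input_mem {s : ℕ} {W : Submodule K ((Fin k → L) → K)}
    (h : IsComputableSpace K L k s W) (j : Fin k) (φ : Module.Dual K L) :
    (fun x => φ (x j)) ∈ W := by
  obtain ⟨w, -, rfl⟩ := h
  exact Submodule.subset_span (Or.inl ⟨j, φ, rfl⟩)

theorem IsComputableSpace.exists_mul_mem {s : ℕ} {W : Submodule K ((Fin k → L) → K)}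
    (h : IsComputableSpace K L k s W) {u v : (Fin k → L) → K} (hu : u ∈ W) (hv : v ∈ W) :
    ∃ W', W ≤ W' ∧ IsComputableSpace K L k (s + 1) W' ∧ u * v ∈ W' := by
  obtain ⟨w, hw, rfl⟩ := h
  let w' : Fin (s + 1) → (Fin k → L) → K := Fin.snoc w (u * v)
  have hcast : ∀ t : Fin s, w' t.castSucc = w t := fun t => Fin.snoc_castSucc _ _ t
  have hlast : w' (Fin.last s) = u * v := Fin.snoc_last _ _
  refine ⟨_, Submodule.span_mono (Set.union_subset_union_right _ ?_), ⟨w', fun t => ?_, rfl⟩, ?_⟩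
  · rintro _ ⟨t, rfl⟩
    exact ⟨t.castSucc, hcast t⟩
  · induction t using Fin.lastCases with
    | last =>
      have hle : Submodule.span K (inputForms K L k ∪ Set.range w) ≤
          Submodule.span K (inputForms K L k ∪ w' '' {t' | t' < Fin.last s}) := by
        refine Submodule.span_mono (Set.union_subset_union_right _ ?_)
        rintro _ ⟨t, rfl⟩
        exact ⟨t.castSucc, t.castSucc_lt_last, hcast t⟩
      exact ⟨u, hle hu, v, hle hv, hlast⟩
    | cast t =>
      have hle : Submodule.span K (inputForms K L k ∪ w '' {t' | t' < t}) ≤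
          Submodule.span K (inputForms K L k ∪ w' '' {t' | t' < t.castSucc}) := by
        refine Submodule.span_mono (Set.union_subset_union_right _ ?_)
        rintro _ ⟨t', ht', rfl⟩
        exact ⟨t'.castSucc, Fin.castSucc_lt_castSucc_iff.2 ht', hcast t'⟩
      obtain ⟨u, hu, v, hv, h⟩ := hw t
      exact ⟨u, hle hu, v, hle hv, by rw [hcast, h]⟩
  · exact Submodule.subset_span (Or.inr ⟨Fin.last s, hlast⟩)

theorem IsComputableSpace.exists_forall_mul_mem {s : ℕ} {W : Submodule K ((Fin k → L) → K)}
    (h : IsComputableSpace K L k s W) {m : ℕ} {u v : Fin m → (Fin k → L) → K}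
    (hu : ∀ i, u i ∈ W) (hv : ∀ i, v i ∈ W) :
    ∃ W', W ≤ W' ∧ IsComputableSpace K L k (s + m) W' ∧ ∀ i, u i * v i ∈ W' := by
  induction m with
  | zero => exact ⟨W, le_rfl, h, fun i => i.elim0⟩
  | succ m ih =>
    obtain ⟨W₁, hW₁, hc₁, h₁⟩ := ih (u := fun i => u i.castSucc) (v := fun i => v i.castSucc)
      (fun i => hu _) (fun i => hv _)
    obtain ⟨W₂, hW₂, hc₂, h₂⟩ := hc₁.exists_mul_mem (hW₁ (hu (Fin.last m))) (hW₁ (hv (Fin.last m)))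
    refine ⟨W₂, hW₁.trans hW₂, hc₂, fun i => ?_⟩
    induction i using Fin.lastCases with
    | last => exact h₂
    | cast i => exact hW₂ (h₁ i)

variable {M : Type*} [Field M] [Algebra K M]

/-- The product of two computed elements of `M` can be computed by means of a bilinear
algorithm. -/
theorem IsComputableSpace.exists_forall_dual_mul_mem {s m : ℕ}
    {W : Submodule K ((Fin k → L) → K)} (h : IsComputableSpace K L k s W)
    (hm : HasMultilinearAlgorithm K M 2 m) {y z : (Fin k → L) → M}
    (hy : ∀ ψ : Module.Dual K M, (fun x => ψ (y x)) ∈ W)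
    (hz : ∀ ψ : Module.Dual K M, (fun x => ψ (z x)) ∈ W) :
    ∃ W', W ≤ W' ∧ IsComputableSpace K L k (s + m) W' ∧
      ∀ ψ : Module.Dual K M, (fun x => ψ (y x * z x)) ∈ W' := by
  obtain ⟨a, c, hac⟩ := hm
  obtain ⟨W', hW', hc, hmul⟩ := h.exists_forall_mul_mem (fun i => hy (a i 0)) (fun i => hz (a i 1))
  refine ⟨W', hW', hc, fun ψ => ?_⟩
  have : (fun x => ψ (y x * z x)) =
      ∑ i, ψ (c i) • ((fun x => a i 0 (y x)) * fun x => a i 1 (z x)) := by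
    funext x
    have := hac ![y x, z x]
    simp only [Fin.prod_univ_two, Matrix.cons_val_zero, Matrix.cons_val_one] at this
    rw [this]
    simp [mul_comm]
  rw [this]
  exact W'.sum_mem fun i _ => W'.smul_mem _ (hmul i)

/-- The first factor is an input and costs nothing; each further factor costs one bilinear product.
Keeping the head `j` apart avoids the empty product. -/
theorem IsComputableSpace.exists_forall_dual_list_prod_mem {s m : ℕ}
    {W : Submodule K ((Fin k → L) → K)} (h : IsComputableSpace K L k s W)
    (hm : HasMultilinearAlgorithm K M 2 m) (ε : L →ₗ[K] M) (j : Fin k) (l : List (Fin k)) :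
    ∃ W', W ≤ W' ∧ IsComputableSpace K L k (s + l.length * m) W' ∧
      ∀ ψ : Module.Dual K M, (fun x => ψ (((j :: l).map fun i => ε (x i)).prod)) ∈ W' := by
  induction l generalizing j with
  | nil => exact ⟨W, le_rfl, by simpa using h, fun ψ => by simpa using h.input_mem j (ψ ∘ₗ ε)⟩
  | cons j' l ih =>
    obtain ⟨W₁, hW₁, hc₁, h₁⟩ := ih j'
    obtain ⟨W₂, hW₂, hc₂, h₂⟩ := hc₁.exists_forall_dual_mul_mem hm
      (y := fun x => ε (x j)) (fun ψ => hc₁.input_mem j (ψ ∘ₗ ε)) h₁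
    refine ⟨W₂, hW₁.trans hW₂, ?_, fun ψ => ?_⟩
    · convert! hc₂ using 1
      rw [List.length_cons]
      ring
    · simpa only [List.map_cons (l := j' :: l), List.prod_cons (l := List.map _ _)] using h₂ ψ

theorem IsComputableSpace.exists_forall_dual_prod_mem {s m : ℕ} (hk : 1 ≤ k)
    {W : Submodule K ((Fin k → L) → K)} (h : IsComputableSpace K L k s W)
    (hm : HasMultilinearAlgorithm K M 2 m) (ε : L →ₗ[K] M) :
    ∃ W', W ≤ W' ∧ IsComputableSpace K L k (s + (k - 1) * m) W' ∧
      ∀ ψ : Module.Dual K M, (fun x => ψ (∏ j, ε (x j))) ∈ W' := by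
  obtain ⟨k, rfl⟩ : ∃ k', k = k' + 1 := ⟨k - 1, by omega⟩
  have := h.exists_forall_dual_list_prod_mem hm ε 0 ((List.finRange k).map Fin.succ)
  rw [← List.finRange_succ, List.length_map, List.length_finRange] at this
  simpa only [Fin.prod_univ_def, Nat.add_sub_cancel] using this

/-- The computations in the various `M i` are run one after another, enlarging a single space; the
final map `Λ` is linear and therefore free. -/
theorem HasInterpolation.hasBilinearComputation {ι : Type*} [Fintype ι] {M : ι → Type*}
    [∀ i, Field (M i)] [∀ i, Algebra K (M i)] (h : HasInterpolation K L k M) (hk : 1 ≤ k)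
    {m : ι → ℕ} (hm : ∀ i, HasMultilinearAlgorithm K (M i) 2 (m i)) :
    HasBilinearComputation K L k (∑ i, (k - 1) * m i) := by
  classical
  obtain ⟨ε, Λ, h⟩ := h
  have key : ∀ T : Finset ι, ∃ W, IsComputableSpace K L k (∑ i ∈ T, (k - 1) * m i) W ∧
      ∀ i ∈ T, ∀ ψ : Module.Dual K (M i), (fun x => ψ (∏ j, ε i (x j))) ∈ W := fun T => by
    induction T using Finset.induction_on with
    | empty => exact ⟨_, isComputableSpace_zero, by simp⟩
    | insert i T hi ih =>
      obtain ⟨W₁, hc₁, h₁⟩ := ih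
      obtain ⟨W₂, hW₂, hc₂, h₂⟩ := hc₁.exists_forall_dual_prod_mem hk (hm i) (ε i)
      refine ⟨W₂, ?_, fun i' hi' ψ => ?_⟩
      · rwa [Finset.sum_insert hi, add_comm]
      · rcases Finset.mem_insert.1 hi' with rfl | hi'
        · exact h₂ ψ
        · exact hW₂ (h₁ i' hi' ψ)
  obtain ⟨W, ⟨w, hw, rfl⟩, hW⟩ := key Finset.univ
  refine ⟨w, hw, fun φ => ?_⟩
  have : (fun x : Fin k → L => φ (∏ j, x j)) =
      ∑ i, fun x => (φ ∘ₗ Λ ∘ₗ LinearMap.single K M i) (∏ j, ε i (x j)) := by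
    funext x
    rw [h x, Finset.sum_apply, ← Finset.univ_sum_single fun i => ∏ j, ε i (x j)]
    simp [← map_sum]
  rw [this]
  exact Submodule.sum_mem _ fun i _ => hW i (Finset.mem_univ i) _

end

end

noncomputable section

/-! ### Complexity bounds -/

theorem multilinearComplexity_spec (K : Type*) [Field K] (k n : ℕ) :
    HasMultilinearAlgorithm K (FiniteExt K n) k (multilinearComplexity K k n) :=
  Nat.sInf_mem (exists_hasMultilinearAlgorithm K (FiniteExt K n) k)

/-- Discard elements while the sum stays above `m`. When the next removal would bring it to `m` or
below, the sum exceeds `m` by at most one term. The condition `0 ≤ m` rules out the empty set. -/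
theorem Finset.exists_subset_sum_le_add {ι : Type*} (S : Finset ι) (d : ι → ℕ) (r : ℕ)
    (hd : ∀ i ∈ S, d i ≤ r) (m : ℤ) (hm : 0 ≤ m) (hS : m < ∑ i ∈ S, (d i : ℤ)) :
    ∃ T ⊆ S, m < ∑ i ∈ T, (d i : ℤ) ∧ ∑ i ∈ T, (d i : ℤ) ≤ m + r := by
  classical
  induction S using Finset.induction_on with
  | empty => simp at hS; omega
  | insert i S hi ih =>
    by_cases h : m < ∑ i ∈ S, (d i : ℤ)
    · obtain ⟨T, hT, h'⟩ := ih (fun j hj => hd j (Finset.mem_insert_of_mem hj)) h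
      exact ⟨T, hT.trans (Finset.subset_insert i S), h'⟩
    · refine ⟨_, subset_rfl, hS, ?_⟩
      rw [Finset.sum_insert hi]
      have := hd i (Finset.mem_insert_self i S)
      omega

section

variable {K F : Type*} [Field K] [Finite K] [Field F] [Algebra K F]
  [Algebra (RatFunc K) F] [IsScalarTower K (RatFunc K) F] [FunctionField K F]

theorem FunctionFieldDivisor.hasInterpolation_finiteExt {D : FunctionFieldDivisor K F}
    {Q : Place K F} (hD : Function.Surjective (D.leadingCoeff Q)) (k : ℕ)
    {S : Finset (Place K F)} (hS : k * D.degree < ∑ P ∈ S, (P.degree : ℤ)) :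
    HasInterpolation K (FiniteExt K Q.degree) k fun P : S => FiniteExt K P.1.degree :=
  (hasInterpolation hD k hS).congr (nonempty_algEquiv_finiteExt Q.degree_pos rfl).some
    fun P => (nonempty_algEquiv_finiteExt P.1.degree_pos rfl).some

theorem multilinearComplexity_le_sum {D : FunctionFieldDivisor K F} {Q : Place K F}
    (hD : Function.Surjective (D.leadingCoeff Q)) (k : ℕ) {S : Finset (Place K F)}
    (hS : k * D.degree < ∑ P ∈ S, (P.degree : ℤ)) :
    multilinearComplexity K k Q.degree ≤ ∑ P ∈ S, multilinearComplexity K k P.degree := by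
  rw [← Finset.sum_coe_sort S fun P => multilinearComplexity K k P.degree]
  exact Nat.sInf_le
    ((FunctionFieldDivisor.hasInterpolation_finiteExt hD k hS).hasMultilinearAlgorithm
      fun P => multilinearComplexity_spec K k P.1.degree)

theorem bilinearComplexity_le_sum {D : FunctionFieldDivisor K F} {Q : Place K F}
    (hD : Function.Surjective (D.leadingCoeff Q)) {k : ℕ} (hk : 1 ≤ k) {S : Finset (Place K F)}
    (hS : k * D.degree < ∑ P ∈ S, (P.degree : ℤ)) :
    bilinearComplexity K k Q.degree ≤ ∑ P ∈ S, (k - 1) * multilinearComplexity K 2 P.degree := by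
  rw [← Finset.sum_coe_sort S fun P => (k - 1) * multilinearComplexity K 2 P.degree]
  exact Nat.sInf_le
    ((FunctionFieldDivisor.hasInterpolation_finiteExt hD k hS).hasBilinearComputation hk
      fun P => multilinearComplexity_spec K 2 P.1.degree)

end

theorem sum_le_mul_of_isLUB {ι : Type*} (T : Finset ι) (d : ι → ℕ) (f : ℕ → ℕ) {r : ℕ}
    (hd : ∀ i ∈ T, d i ∈ Set.Icc 1 r) {c b : ℝ} (hc : 0 ≤ c)
    (h : IsLUB ((fun i : ℕ => (f i : ℝ) / i) '' Set.Icc 1 r) c) (hT : ∑ i ∈ T, (d i : ℝ) ≤ b) :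
    ∑ i ∈ T, (f (d i) : ℝ) ≤ b * c := by
  refine le_trans ?_ (mul_le_mul_of_nonneg_right hT hc)
  rw [Finset.sum_mul]
  refine Finset.sum_le_sum fun i hi => ?_
  have hpos : (0 : ℝ) < d i := by exact_mod_cast (hd i hi).1
  have := h.1 ⟨d i, hd i hi, rfl⟩
  simp only [div_le_iff₀ hpos] at this
  linarith

end

/-! ### The complexity bounds -/

theorem theorem2p2 {K F : Type*} [Field K] [Finite K] [Field F] [Algebra K F]
    [Algebra (RatFunc K) F] [IsScalarTower K (RatFunc K) F] [FunctionField K F]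
    (k n r : ℕ) (hk : 2 ≤ k) (hn : 1 < n) (hr : 1 ≤ r)
    (g : ℤ) (hg : functionFieldGenus K F = g)
    (hQ : ∃ Q : Place K F, Q.degree = n)
    (hR : ∃ R : FunctionFieldDivisor K F, R.IsNonspecial ∧ R.degree = g - 1)
    (P : ℕ → Finset (Place K F))
    (hP : ∀ i ∈ Finset.Icc 1 r, ∀ p ∈ P i, p.degree = i)
    (hmain : (∑ i ∈ Finset.Icc 1 r, (i : ℤ) * ((P i).card : ℤ)) > k * n + k * g - k) :
    multilinearComplexity K k n
        ≤ ∑ i ∈ Finset.Icc 1 r, (P i).card * multilinearComplexity K k i ∧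
    (∀ r₀ : ℕ, 1 ≤ r₀ →
      IsLUB ((fun i : ℕ => (multilinearComplexity K k i : ℝ) / i) '' Set.Icc 1 r)
        ((multilinearComplexity K k r₀ : ℝ) / r₀) →
      (multilinearComplexity K k n : ℝ)
        ≤ (k * n + k * g - k + r) * ((multilinearComplexity K k r₀ : ℝ) / r₀)) ∧
    (∀ r₀' : ℕ, 1 ≤ r₀' →
      IsLUB ((fun i : ℕ => (multilinearComplexity K 2 i : ℝ) / i) '' Set.Icc 1 r)
        ((multilinearComplexity K 2 r₀' : ℝ) / r₀') →
      (bilinearComplexity K k n : ℝ)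
        ≤ (k - 1) * (k * n + k * g - k + r) *
          ((multilinearComplexity K 2 r₀' : ℝ) / r₀')) := by
  classical
  obtain ⟨Q, rfl⟩ := hQ
  obtain ⟨R, hR, hRdeg⟩ := hR
  subst hg
  have hD := FunctionFieldDivisor.leadingCoeff_surjective_of_isNonspecial hR hRdeg Q
  set g := functionFieldGenus K F
  set D := R + Finsupp.single Q 1
  have hDdeg : k * D.degree = (k * Q.degree + k * g - k : ℤ) := by
    rw [FunctionFieldDivisor.degree_add, FunctionFieldDivisor.degree_single, hRdeg]
    ring
  set S := (Finset.Icc 1 r).biUnion P with hSdef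
  have hdisj : Set.PairwiseDisjoint (Finset.Icc 1 r : Set ℕ) P := by
    intro i hi j hj hij
    rw [Function.onFun, Finset.disjoint_left]
    intro p hp hp'
    exact hij ((hP i hi p hp).symm.trans (hP j hj p hp'))
  -- Stated for any semiring because it is needed in `ℤ` for degrees and in `ℕ` for complexities.
  have hsum : ∀ {A : Type} [Semiring A] (f : ℕ → A),
      ∑ p ∈ S, f p.degree = ∑ i ∈ Finset.Icc 1 r, ((P i).card : A) * f i := fun f => by
    rw [hSdef, Finset.sum_biUnion hdisj]
    refine Finset.sum_congr rfl fun i hi => ?_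
    rw [Finset.sum_congr rfl fun p hp => by rw [hP i hi p hp], Finset.sum_const, nsmul_eq_mul]
  have hSdeg : ∀ p ∈ S, p.degree ∈ Set.Icc 1 r := fun p hp => by
    obtain ⟨i, hi, hp⟩ := Finset.mem_biUnion.1 hp
    rw [hP i hi p hp]
    exact Finset.mem_Icc.1 hi
  have hS : k * D.degree < ∑ p ∈ S, (p.degree : ℤ) := by
    rw [hDdeg, hsum fun i => (i : ℤ)]
    simpa only [mul_comm] using hmain
  -- The total degree of `S` has no upper bound; `T` still suffices for interpolation and overshoots
  -- `deg kD` by at most `r`, which is the `+ r` in the last two bounds.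
  obtain ⟨T, hTS, hT, hT'⟩ := S.exists_subset_sum_le_add Place.degree r
    (fun p hp => (hSdeg p hp).2) (k * D.degree)
    (mul_nonneg (by positivity)
      (FunctionFieldDivisor.degree_nonneg_of_leadingCoeff_surjective hD)) hS
  have hTdeg : ∑ p ∈ T, (p.degree : ℝ) ≤ k * Q.degree + k * g - k + r := by
    rw [hDdeg] at hT'
    exact_mod_cast hT'
  have hTmem : ∀ p ∈ T, p.degree ∈ Set.Icc 1 r := fun p hp => hSdeg p (hTS hp)
  refine ⟨?_, fun r₀ _ h => ?_, fun r₀' _ h => ?_⟩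
  · refine (multilinearComplexity_le_sum hD k hS).trans_eq ?_
    simpa using hsum fun i => multilinearComplexity K k i
  · have h1 : (multilinearComplexity K k Q.degree : ℝ) ≤
        ∑ p ∈ T, (multilinearComplexity K k p.degree : ℝ) := by
      exact_mod_cast multilinearComplexity_le_sum hD k hT
    exact h1.trans (sum_le_mul_of_isLUB T Place.degree _ hTmem (by positivity) h hTdeg)
  · have h1 : (bilinearComplexity K k Q.degree : ℝ) ≤
        (k - 1) * ∑ p ∈ T, (multilinearComplexity K 2 p.degree : ℝ) := by
      have := bilinearComplexity_le_sum hD (by omega : 1 ≤ k) hT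
      rw [← Finset.mul_sum] at this
      have hk1 : ((k - 1 : ℕ) : ℝ) = k - 1 := by rw [Nat.cast_sub (by omega), Nat.cast_one]
      rw [← hk1]
      exact_mod_cast this
    refine h1.trans ?_
    rw [mul_assoc]
    refine mul_le_mul_of_nonneg_left
      (sum_le_mul_of_isLUB T Place.degree _ hTmem (by positivity) h hTdeg) ?_
    have : (2 : ℝ) ≤ k := by exact_mod_cast hk
    linarith
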